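/- Let $\gamma>0$ and let $q\in L^1(0,\infty)$ be a (complex-valued) function such that $\int_0^\infty e^{4at}|q(t)|\,dt<\infty$ for some $a>0$ (Naimark condition); fix such an $a$. For $R>0$ let $H_R=-\frac{d^2}{dx^2}+q+i\gamma\chi_{[0,R]}$ on $L^2(0,\infty)$ with a Dirichlet boundary condition at $0$, that is, on the domain of all $u\in L^2(0,\infty)$ such that $u,u'$ are locally absolutely continuous on $[0,\infty)$, $u(0)=0$ and $-u''+(q+i\gamma\chi_{[0,R]})u\in L^2(0,\infty)$. Let $N(H_R)$ be the number of eigenvalues of $H_R$, counted with algebraic multiplicity, and let $\Gamma_\gamma=(0,\infty)\times i(0,\gamma)\subset\mathbb C$ and $B_X(0)=\{z\in\mathbb C:|z|<X\}$. Then there exists $X>0$ such that $(\ast)$ for every $R>0$, all eigenvalues of $H_R$ lie in $B_X(0)\cup\Gamma_\gamma$. Moreover, for every $X>0$ with property $(\ast)$ there exists $R_0>0$ such that for every $R\ge R_0$, $$N(H_R)\le 88788\,\frac{\sqrt X+a}{a^2}\,\frac{\gamma^2R^3}{(\log R)^2}.$$ -/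

import Mathlib

open MeasureTheory Set
open scoped ENNReal

/-- The Hilbert space `L²(0,∞)`. -/
abbrev L2HalfLine : Type := Lp ℂ 2 (volume.restrict (Ioi (0 : ℝ)))

/-- `IsDirichletPair V u v f g`: the function `f` is a representative of `u ∈ L²(0,∞)` that is
continuously differentiable on `[0,∞)` with derivative `g`, `f 0 = 0`, the function `g` is locally
absolutely continuous on `[0,∞)` with `g' = V f - v` almost everywhere (written as: `g` is the
indefinite integral of the locally integrable function `V f - v`).
In other words, `-f'' + V f = v` and `f 0 = 0`. -/
structure IsDirichletPair (V : ℝ → ℂ) (u v : L2HalfLine) (f g : ℝ → ℂ) : Prop where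
  ae_eq : (u : ℝ → ℂ) =ᵐ[volume.restrict (Ioi (0 : ℝ))] f
  dirichlet : f 0 = 0
  deriv : ∀ x : ℝ, 0 ≤ x → HasDerivWithinAt f (g x) (Ici 0) x
  locInt : ∀ x : ℝ, 0 ≤ x → IntervalIntegrable (fun t => V t * f t - v t) volume 0 x
  eq_integral : ∀ x : ℝ, 0 ≤ x → g x = g 0 + ∫ t in (0 : ℝ)..x, (V t * f t - v t)

theorem l2HalfLine_intervalIntegrable (v : L2HalfLine) (x : ℝ) (hx : 0 ≤ x) :
    IntervalIntegrable (v : ℝ → ℂ) volume 0 x := by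
  rw [intervalIntegrable_iff_integrableOn_Ioc_of_le hx]
  have h1 : MemLp (v : ℝ → ℂ) 2 (volume.restrict (Ioc 0 x)) :=
    (Lp.memLp v).mono_measure (Measure.restrict_mono (fun t ht => ht.1) le_rfl)
  exact h1.integrable (by norm_num)

theorem l2HalfLine_ae_uIoc {a b : ℝ → ℂ} (h : a =ᵐ[volume.restrict (Ioi (0 : ℝ))] b)
    (x : ℝ) (hx : 0 ≤ x) : a =ᵐ[volume.restrict (uIoc 0 x)] b := by
  rw [uIoc_of_le hx]
  exact ae_mono (Measure.restrict_mono (fun t ht => ht.1) le_rfl) h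

/-- The graph of the maximal realisation of `-d²/dx² + V` in `L²(0,∞)` with a Dirichlet boundary
condition at `0`: its domain is the set of `u ∈ L²(0,∞)` with `u, u'` locally absolutely continuous
on `[0,∞)`, `u(0) = 0` and `-u'' + V u ∈ L²(0,∞)`. -/
def schrodingerGraph (V : ℝ → ℂ) : Submodule ℂ (L2HalfLine × L2HalfLine) where
  carrier := {p | ∃ f g : ℝ → ℂ, IsDirichletPair V p.1 p.2 f g}
  zero_mem' := by
    have h0 := Lp.coeFn_zero ℂ 2 (volume.restrict (Ioi (0 : ℝ)))
    have hc : ∀ x : ℝ, 0 ≤ x →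
        (fun t => V t * (0 : ℝ → ℂ) t - ((0 : L2HalfLine) : ℝ → ℂ) t)
          =ᵐ[volume.restrict (uIoc 0 x)] fun _ => (0 : ℂ) := by
      intro x hx
      filter_upwards [l2HalfLine_ae_uIoc h0 x hx] with t ht
      rw [ht]
      simp
    refine ⟨0, 0, h0, rfl, fun x _ => hasDerivWithinAt_const _ _ _, fun x hx => ?_, fun x hx => ?_⟩
    · exact (intervalIntegrable_congr_ae (hc x hx)).2 intervalIntegrable_const
    · have : ∫ t in (0 : ℝ)..x, (V t * (0 : ℝ → ℂ) t - ((0 : L2HalfLine) : ℝ → ℂ) t) = 0 := by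
        rw [intervalIntegral.integral_congr_ae_restrict (hc x hx)]
        simp
      simpa using this.symm
  add_mem' := by
    rintro ⟨u₁, v₁⟩ ⟨u₂, v₂⟩ ⟨f₁, g₁, h₁⟩ ⟨f₂, g₂, h₂⟩
    have hc : ∀ x : ℝ, 0 ≤ x →
        (fun t => V t * (f₁ + f₂) t - ((v₁ + v₂ : L2HalfLine) : ℝ → ℂ) t)
          =ᵐ[volume.restrict (uIoc 0 x)]
          fun t => (V t * f₁ t - v₁ t) + (V t * f₂ t - v₂ t) := by
      intro x hx
      filter_upwards [l2HalfLine_ae_uIoc (Lp.coeFn_add v₁ v₂) x hx] with t ht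
      simp only [ht, Pi.add_apply]
      ring
    refine ⟨f₁ + f₂, g₁ + g₂, (Lp.coeFn_add u₁ u₂).trans (h₁.ae_eq.add h₂.ae_eq), ?_,
      fun x hx => (h₁.deriv x hx).add (h₂.deriv x hx), fun x hx => ?_, fun x hx => ?_⟩
    · simp [h₁.dirichlet, h₂.dirichlet]
    · exact (intervalIntegrable_congr_ae (hc x hx)).2 ((h₁.locInt x hx).add (h₂.locInt x hx))
    · refine Eq.trans ?_ (congrArg _ (intervalIntegral.integral_congr_ae_restrict (hc x hx)).symm)
      rw [intervalIntegral.integral_add (h₁.locInt x hx) (h₂.locInt x hx)]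
      simp only [Pi.add_apply]
      rw [h₁.eq_integral x hx, h₂.eq_integral x hx]
      ring
  smul_mem' := by
    rintro c ⟨u, v⟩ ⟨f, g, h⟩
    have hc : ∀ x : ℝ, 0 ≤ x →
        (fun t => V t * (c • f) t - ((c • v : L2HalfLine) : ℝ → ℂ) t)
          =ᵐ[volume.restrict (uIoc 0 x)] fun t => c * (V t * f t - v t) := by
      intro x hx
      filter_upwards [l2HalfLine_ae_uIoc (Lp.coeFn_smul c v) x hx] with t ht
      simp only [ht, Pi.smul_apply, smul_eq_mul]
      ring
    refine ⟨c • f, c • g, (Lp.coeFn_smul c u).trans (h.ae_eq.const_smul c), ?_,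
      fun x hx => (h.deriv x hx).const_smul c, fun x hx => ?_, fun x hx => ?_⟩
    · simp [h.dirichlet]
    · exact (intervalIntegrable_congr_ae (hc x hx)).2 ((h.locInt x hx).const_mul c)
    · refine Eq.trans ?_ (congrArg _ (intervalIntegral.integral_congr_ae_restrict (hc x hx)).symm)
      rw [intervalIntegral.integral_const_mul]
      simp only [Pi.smul_apply, smul_eq_mul]
      rw [h.eq_integral x hx]
      ring

/-- `schrodingerGraph V` is single-valued, so it is the graph of an operator. -/
theorem schrodingerGraph_snd_eq_zero (V : ℝ → ℂ) (p : L2HalfLine × L2HalfLine)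
    (hp : p ∈ schrodingerGraph V) (hp1 : p.1 = 0) : p.2 = 0 := by
  obtain ⟨f, g, h⟩ := hp
  have hf0 : f =ᵐ[volume.restrict (Ioi (0 : ℝ))] fun _ => (0 : ℂ) := by
    have h1 := h.ae_eq
    rw [hp1] at h1
    exact h1.symm.trans (Lp.coeFn_zero ℂ 2 _)
  have hcont : ContinuousOn f (Ici 0) := fun x hx => (h.deriv x hx).continuousWithinAt
  have hfI : EqOn f (fun _ => (0 : ℂ)) (Ioi 0) :=
    Measure.eqOn_open_of_ae_eq hf0 isOpen_Ioi (hcont.mono Ioi_subset_Ici_self) continuousOn_const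
  have hf : EqOn f (fun _ => (0 : ℂ)) (Ici 0) := by
    intro x hx
    rcases eq_or_lt_of_le (show (0 : ℝ) ≤ x from hx) with h0 | h0
    · rw [← h0]; exact h.dirichlet
    · exact hfI h0
  have hg : ∀ x : ℝ, 0 ≤ x → g x = 0 := by
    intro x hx
    have h1 : HasDerivWithinAt f 0 (Ici 0) x :=
      (hasDerivWithinAt_const x (Ici 0) (0 : ℂ)).congr hf (hf hx)
    exact (uniqueDiffOn_Ici (0 : ℝ) x hx).eq_deriv _ (h.deriv x hx) h1
  have hv : ∀ x : ℝ, 0 ≤ x → ∫ t in (0 : ℝ)..x, (p.2 : ℝ → ℂ) t = 0 := by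
    intro x hx
    have h1 := h.eq_integral x hx
    rw [hg x hx, hg 0 le_rfl, zero_add] at h1
    have h2 : ∫ t in (0 : ℝ)..x, (V t * f t - (p.2 : ℝ → ℂ) t)
        = ∫ t in (0 : ℝ)..x, -((p.2 : ℝ → ℂ) t) := by
      refine intervalIntegral.integral_congr fun t ht => ?_
      rw [uIcc_of_le hx] at ht
      simp [hf ht.1]
    rw [h2, intervalIntegral.integral_neg] at h1
    exact neg_eq_zero.1 h1.symm
  rw [Lp.eq_zero_iff_ae_eq_zero]
  have hae : ∀ n : ℕ, ∀ᵐ x, x ∈ uIcc (0 : ℝ) n → ∀ c ∈ uIcc (0 : ℝ) n,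
      HasDerivAt (fun x => ∫ t in c..x, (p.2 : ℝ → ℂ) t) ((p.2 : ℝ → ℂ) x) x := fun n =>
    (l2HalfLine_intervalIntegrable p.2 n n.cast_nonneg).ae_hasDerivAt_integral
  refine (ae_restrict_iff' measurableSet_Ioi).2 ?_
  filter_upwards [ae_all_iff.2 hae] with x hx hx0
  obtain ⟨n, hn⟩ := exists_nat_ge x
  have hx0' : (0 : ℝ) < x := hx0
  have h1 := hx n (by rw [uIcc_of_le n.cast_nonneg]; exact ⟨hx0'.le, hn⟩) 0 left_mem_uIcc
  have h2 : (fun x => ∫ t in (0 : ℝ)..x, (p.2 : ℝ → ℂ) t) =ᶠ[nhds x] fun _ => (0 : ℂ) := by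
    filter_upwards [Ioi_mem_nhds hx0'] with y hy
    exact hv y (le_of_lt hy)
  exact h1.unique ((hasDerivAt_const x (0 : ℂ)).congr_of_eventuallyEq h2)

/-- The operator `-d²/dx² + V` on `L²(0,∞)` with a Dirichlet boundary condition at `0`. -/
noncomputable def schrodingerOp (V : ℝ → ℂ) : L2HalfLine →ₗ.[ℂ] L2HalfLine :=
  (schrodingerGraph V).toLinearPMap

theorem schrodingerOp_graph (V : ℝ → ℂ) : (schrodingerOp V).graph = schrodingerGraph V :=
  Submodule.toLinearPMap_graph_eq _ (schrodingerGraph_snd_eq_zero V)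

/-- The operator `H_R = -d²/dx² + q + i γ χ_{[0,R]}` on `L²(0,∞)`, Dirichlet condition at `0`. -/
noncomputable def dissipativeOp (q : ℝ → ℂ) (γ R : ℝ) : L2HalfLine →ₗ.[ℂ] L2HalfLine :=
  schrodingerOp fun x => q x + (Icc 0 R).indicator (fun _ => Complex.I * (γ : ℂ)) x

section Eigenvalues

variable {E : Type*} [AddCommGroup E] [Module ℂ E]

/-- `z` is an eigenvalue of the (unbounded) operator `T`. -/
def IsEigenvalue (T : E →ₗ.[ℂ] E) (z : ℂ) : Prop :=
  ∃ u : T.domain, (u : E) ≠ 0 ∧ T u = z • (u : E)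

/-- `ker (T - z)ⁿ` for an unbounded operator `T`: the vectors `u` for which
`u, (T - z) u, …, (T - z)ⁿ⁻¹ u` all lie in the domain of `T` and `(T - z)ⁿ u = 0`. -/
def powKer (T : E →ₗ.[ℂ] E) (z : ℂ) : ℕ → Submodule ℂ E
  | 0 => ⊥
  | n + 1 => ((powKer T z n).comap (T.toFun - z • T.domain.subtype)).map T.domain.subtype

/-- The algebraic multiplicity of `z`: the dimension of the root subspace `⋃ₙ ker (T - z)ⁿ`. -/
noncomputable def algMultiplicity (T : E →ₗ.[ℂ] E) (z : ℂ) : ℕ∞ :=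
  Cardinal.toENat (Module.rank ℂ (⨆ n : ℕ, powKer T z n : Submodule ℂ E))

/-- The number of eigenvalues of `T`, counted with algebraic multiplicity (possibly `∞`). -/
noncomputable def numEigenvalues (T : E →ₗ.[ℂ] E) : ℝ≥0∞ :=
  ∑' z : {z : ℂ // IsEigenvalue T z}, (algMultiplicity T z : ℝ≥0∞)

end Eigenvalues

/-- The half-strip `Γ_γ = (0,∞) × i(0,γ)`. -/
def halfStrip (γ : ℝ) : Set ℂ := {z | 0 < z.re ∧ 0 < z.im ∧ z.im < γ}

/-- For every `R > 0`, all eigenvalues of `H_R` lie in `B_X(0) ∪ Γ_γ`. -/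
def EnclosesEigenvalues (q : ℝ → ℂ) (γ X : ℝ) : Prop :=
  ∀ R : ℝ, 0 < R → ∀ z : ℂ, IsEigenvalue (dissipativeOp q γ R) z →
    z ∈ Metric.ball (0 : ℂ) X ∪ halfStrip γ

open Filter Topology

/-! ### Indefinite integrals -/

section Primitive

/-! Write V for the potential with the barrier and let ψ(x) = e^{ikx} m(x) be the Jost solution of
-ψ'' + Vψ = k²ψ. Every eigenvalue is k² with Im k > 0 and m(0) = 0. The algebraic multiplicity is at
most the order of the zero (`algMultiplicity_le_analyticOrderAt`), so the task is to count zeros of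
the Jost function F(k) = m(0) in the upper half-plane.

The Volterra equation for m has kernel (e^{2ik(t-x)} - 1)/(2ik). Naimark's condition and the bounded
support of the barrier make F holomorphic on Im k > -1/R for R ≥ 1/a. There the Neumann series gives
|F| ≤ exp(CR²) and |F - 1| ≤ exp(CR/|k|) - 1 with C independent of R (`exists_barrier_bound`): the
weight e^{2t/R} is at most e² on the barrier.

For the count (`sum_analyticOrderNatAt_le`), take h = K(2/R - ik)^{-7/8} with K of order R^{9/8}.
Then Re h dominates log|F| on the strip, so F e^{-h} is bounded by 1. Jensen's inequality is applied
in a disc with centre ir, r of order R³, reaching slightly below the real axis. At the centre -log|F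
e^{-h}| is O(R^{-3/2}), and the logarithm of the ratio of the two radii is at least of order R^{-4}.
Hence there are O(R^{5/2}) zeros, which is o(R³/log² R). The stated bound therefore holds for large
R, whatever the positive constant in front.

For the enclosure (`exists_enclosesEigenvalues`), let κ² = k² - iγ. If k² lies outside the
half-strip, a root κ with Im κ ≥ 0 can be taken close to k (`exists_sqrt_near`). The barrier then
hardly reflects, and for large |k| the function e^{-iκx}ψ(x) is nearly constant on [0,R], so F(k)
cannot vanish (`jostM_zero_ne_zero`). -/

theorem IntervalIntegrable.comp_neg_left {E : Type*} [NormedAddCommGroup E] {f : ℝ → E} {a b : ℝ}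
    (h : IntervalIntegrable f volume a b) :
    IntervalIntegrable (fun x => f (-x)) volume (-a) (-b) := by
  simpa using h.comp_sub_left 0

variable {𝕜 : Type*} [RCLike 𝕜]

/-- On `[a, b]` the function `f` is an indefinite integral of the integrable function `f'`. -/
structure IsPrimitiveOn (f f' : ℝ → 𝕜) (a b : ℝ) : Prop where
  le : a ≤ b
  int : IntervalIntegrable f' volume a b
  eq : ∀ x ∈ Icc a b, f x = f a + ∫ t in a..x, f' t

namespace IsPrimitiveOn

variable {f f' g g' : ℝ → 𝕜} {a b : ℝ}

theorem intOn (h : IsPrimitiveOn f f' a b) {x y : ℝ} (hx : x ∈ Icc a b) (hy : y ∈ Icc a b) :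
    IntervalIntegrable f' volume x y :=
  h.int.mono_set (by
    rw [uIcc_of_le h.le]
    exact uIcc_subset_Icc hx hy)

theorem sub_eq (h : IsPrimitiveOn f f' a b) {x y : ℝ} (hx : x ∈ Icc a b) (hy : y ∈ Icc a b) :
    f y - f x = ∫ t in x..y, f' t := by
  have ha : a ∈ Icc a b := left_mem_Icc.2 h.le
  rw [h.eq x hx, h.eq y hy, ← intervalIntegral.integral_interval_sub_left (h.intOn ha hy)
    (h.intOn ha hx)]
  ring

theorem mono (h : IsPrimitiveOn f f' a b) {c d : ℝ} (hc : a ≤ c) (hcd : c ≤ d) (hd : d ≤ b) :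
    IsPrimitiveOn f f' c d where
  le := hcd
  int := h.intOn ⟨hc, hcd.trans hd⟩ ⟨hc.trans hcd, hd⟩
  eq x hx := by
    rw [← h.sub_eq ⟨hc, hcd.trans hd⟩ ⟨hc.trans hx.1, hx.2.trans hd⟩]
    ring

/-- Increments of `f` are dominated by those of the primitive of `‖f'‖`, whose absolute continuity
is known. -/
theorem absolutelyContinuous (h : IsPrimitiveOn f f' a b) :
    AbsolutelyContinuousOnInterval f a b := by
  have hP := h.int.norm.absolutelyContinuousOnInterval_intervalIntegral (c := a) (by simp)
  unfold AbsolutelyContinuousOnInterval at hP ⊢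
  refine squeeze_zero' (Eventually.of_forall fun _ => Finset.sum_nonneg fun i _ => dist_nonneg)
    ?_ hP
  rw [eventually_inf_principal]
  filter_upwards with ⟨n, I⟩ hI
  refine Finset.sum_le_sum fun i hi => ?_
  simp only [AbsolutelyContinuousOnInterval.disjWithin, mem_ofPred_eq] at hI
  obtain ⟨h1, h2⟩ := hI.1 i hi
  rw [uIcc_of_le h.le] at h1 h2
  have ha : a ∈ Icc a b := left_mem_Icc.2 h.le
  rw [dist_comm, dist_comm (∫ v in a..(I i).1, ‖f' v‖), dist_eq_norm, Real.dist_eq, h.sub_eq h1 h2,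
    intervalIntegral.integral_interval_sub_left (h.intOn ha h2).norm (h.intOn ha h1).norm]
  exact intervalIntegral.norm_integral_le_abs_integral_norm

theorem continuousOn (h : IsPrimitiveOn f f' a b) : ContinuousOn f (Icc a b) := by
  have := h.absolutelyContinuous.continuousOn
  rwa [uIcc_of_le h.le] at this

theorem ae_hasDerivAt (h : IsPrimitiveOn f f' a b) :
    ∀ᵐ x, x ∈ uIcc a b → HasDerivAt f (f' x) x := by
  have hne : ∀ c : ℝ, ∀ᵐ x : ℝ, x ≠ c := fun c => by simp [ae_iff]
  filter_upwards [h.int.ae_hasDerivAt_integral, hne a, hne b] with x hx hxa hxb hxI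
  have h1 := (hx hxI a left_mem_uIcc).const_add (f a)
  rw [uIcc_of_le h.le] at hxI
  refine h1.congr_of_eventuallyEq ?_
  filter_upwards [Ioo_mem_nhds (lt_of_le_of_ne hxI.1 hxa.symm) (lt_of_le_of_ne hxI.2 hxb)]
    with y hy
  exact h.eq y (Ioo_subset_Icc_self hy)

/-- The difference between `f` and the primitive of `f'` is absolutely continuous with zero
derivative almost everywhere, hence constant. This is what gives the product rule for primitives
with merely integrable derivatives. -/
theorem of_absolutelyContinuous (hab : a ≤ b) (hf : AbsolutelyContinuousOnInterval f a b)
    (hf' : IntervalIntegrable f' volume a b)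
    (hd : ∀ᵐ x, x ∈ uIcc a b → HasDerivAt f (f' x) x) : IsPrimitiveOn f f' a b := by
  refine ⟨hab, hf', fun x hx => ?_⟩
  have hP : IsPrimitiveOn (fun x => ∫ t in a..x, f' t) f' a b := ⟨hab, hf', fun y _ => by simp⟩
  obtain ⟨C, hC⟩ := (hf.sub hP.absolutelyContinuous).const_of_ae_hasDerivAt_zero (by
    filter_upwards [hd, hP.ae_hasDerivAt] with y h1 h2 hy
    simpa using (h1 hy).sub (h2 hy))
  have h1 := hC x (by rwa [uIcc_of_le hab])
  have h2 := hC a left_mem_uIcc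
  simp only [Pi.sub_apply, intervalIntegral.integral_same, sub_zero] at h1 h2
  rw [h2, ← h1]
  ring

theorem congr_deriv {f'' : ℝ → 𝕜} (h : IsPrimitiveOn f f' a b) (h' : ∀ x ∈ Icc a b, f' x = f'' x) :
    IsPrimitiveOn f f'' a b := by
  have hc : ∀ x ∈ Icc a b, EqOn f' f'' (uIcc a x) := fun x hx t ht => by
    rw [uIcc_of_le hx.1] at ht
    exact h' t ⟨ht.1, ht.2.trans hx.2⟩
  have hb := right_mem_Icc.2 h.le
  refine ⟨h.le, h.int.congr fun t ht => hc b hb (uIoc_subset_uIcc ht), fun x hx => ?_⟩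
  rw [h.eq x hx, intervalIntegral.integral_congr (hc x hx)]

theorem congr_deriv_ae {f'' : ℝ → 𝕜} (h : IsPrimitiveOn f f' a b)
    (h' : f' =ᵐ[volume.restrict (Ioc a b)] f'') : IsPrimitiveOn f f'' a b := by
  have hc : ∀ x ∈ Icc a b, f' =ᵐ[volume.restrict (uIoc a x)] f'' := fun x hx => by
    rw [uIoc_of_le hx.1]
    exact ae_mono (Measure.restrict_mono (Ioc_subset_Ioc_right hx.2) le_rfl) h'
  refine ⟨h.le, (intervalIntegrable_congr_ae (hc b (right_mem_Icc.2 h.le))).1 h.int,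
    fun x hx => ?_⟩
  rw [h.eq x hx, intervalIntegral.integral_congr_ae_restrict (hc x hx)]

theorem congr {k : ℝ → 𝕜} (h : IsPrimitiveOn f f' a b) (h' : ∀ x ∈ Icc a b, f x = k x) :
    IsPrimitiveOn k f' a b :=
  ⟨h.le, h.int, fun x hx => by rw [← h' x hx, ← h' a (left_mem_Icc.2 h.le), h.eq x hx]⟩

theorem const (hab : a ≤ b) (c : 𝕜) : IsPrimitiveOn (fun _ => c) (fun _ => 0) a b :=
  ⟨hab, intervalIntegrable_const, fun x _ => by simp⟩

theorem add (hf : IsPrimitiveOn f f' a b) (hg : IsPrimitiveOn g g' a b) :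
    IsPrimitiveOn (fun x => f x + g x) (fun x => f' x + g' x) a b := by
  refine ⟨hf.le, hf.int.add hg.int, fun x hx => ?_⟩
  have ha : a ∈ Icc a b := left_mem_Icc.2 hf.le
  rw [intervalIntegral.integral_add (hf.intOn ha hx) (hg.intOn ha hx), hf.eq x hx, hg.eq x hx]
  ring

theorem mul (hf : IsPrimitiveOn f f' a b) (hg : IsPrimitiveOn g g' a b) :
    IsPrimitiveOn (fun x => f x * g x) (fun x => f' x * g x + f x * g' x) a b := by
  refine of_absolutelyContinuous hf.le (hf.absolutelyContinuous.smul hg.absolutelyContinuous) ?_ ?_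
  · exact (hf.int.mul_continuousOn hg.absolutelyContinuous.continuousOn).add
      (hg.int.continuousOn_mul hf.absolutelyContinuous.continuousOn)
  · filter_upwards [hf.ae_hasDerivAt, hg.ae_hasDerivAt] with x h1 h2 hx
    exact (h1 hx).mul (h2 hx)

theorem const_mul (hf : IsPrimitiveOn f f' a b) (c : 𝕜) :
    IsPrimitiveOn (fun x => c * f x) (fun x => c * f' x) a b :=
  ((const hf.le c).mul hf).congr_deriv fun x _ => by ring

theorem neg (hf : IsPrimitiveOn f f' a b) :
    IsPrimitiveOn (fun x => -f x) (fun x => -f' x) a b :=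
  ((hf.const_mul (-1)).congr_deriv fun x _ => by ring).congr fun x _ => by ring

theorem sub (hf : IsPrimitiveOn f f' a b) (hg : IsPrimitiveOn g g' a b) :
    IsPrimitiveOn (fun x => f x - g x) (fun x => f' x - g' x) a b :=
  ((hf.add hg.neg).congr_deriv fun x _ => by ring).congr fun x _ => by ring

theorem pow_succ (hf : IsPrimitiveOn f f' a b) (n : ℕ) :
    IsPrimitiveOn (fun x => f x ^ (n + 1)) (fun x => (n + 1) * (f' x * f x ^ n)) a b := by
  induction n with
  | zero => exact (hf.congr_deriv fun x _ => by simp).congr fun x _ => by simp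
  | succ n ih =>
    refine ((ih.mul hf).congr_deriv fun x _ => ?_).congr fun x _ => by ring
    push_cast
    ring

theorem of_hasDerivWithinAt (hab : a ≤ b) (hd : ∀ x ∈ Icc a b, HasDerivWithinAt f (f' x) (Icc a b) x)
    (hc : ContinuousOn f' (Icc a b)) : IsPrimitiveOn f f' a b := by
  refine ⟨hab, hc.intervalIntegrable_of_Icc hab, fun x hx => ?_⟩
  have h1 : ContinuousOn f (Icc a x) := fun y hy =>
    (hd y ⟨hy.1, hy.2.trans hx.2⟩).continuousWithinAt.mono (Icc_subset_Icc_right hx.2)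
  rw [intervalIntegral.integral_eq_sub_of_hasDerivAt_of_le hx.1 h1 (fun y hy =>
    (hd y ⟨hy.1.le, hy.2.le.trans hx.2⟩).hasDerivAt (Icc_mem_nhds hy.1 (hy.2.trans_le hx.2)))
    ((hc.mono (Icc_subset_Icc_right hx.2)).intervalIntegrable_of_Icc hx.1)]
  ring

theorem of_hasDerivAt (hab : a ≤ b) (hd : ∀ x, HasDerivAt f (f' x) x) (hc : Continuous f') :
    IsPrimitiveOn f f' a b :=
  of_hasDerivWithinAt hab (fun x _ => (hd x).hasDerivWithinAt) hc.continuousOn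

/-- Tail integrals are primitives. -/
theorem integral_Ioi {F : ℝ → 𝕜} (hab : a ≤ b) (hF : IntegrableOn F (Ioi a)) :
    IsPrimitiveOn (fun x => ∫ t in Ioi x, F t) (fun x => -F x) a b := by
  have hI : ∀ x, a ≤ x → IntervalIntegrable F volume a x := fun x hx => by
    rw [intervalIntegrable_iff_integrableOn_Ioc_of_le hx]
    exact hF.mono_set Ioc_subset_Ioi_self
  refine ⟨hab, (hI b hab).neg, fun x hx => ?_⟩
  rw [intervalIntegral.integral_neg, intervalIntegral.integral_of_le hx.1]
  have := setIntegral_union (μ := volume) (f := F) (Ioc_disjoint_Ioi_same (a := a) (b := x))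
    measurableSet_Ioi (hF.mono_set Ioc_subset_Ioi_self) (hF.mono_set (Ioi_subset_Ioi hx.1))
  rw [Ioc_union_Ioi_eq_Ioi hx.1] at this
  rw [this]
  ring

theorem comp_neg (hf : IsPrimitiveOn f f' a b) :
    IsPrimitiveOn (fun x => f (-x)) (fun x => -f' (-x)) (-b) (-a) := by
  refine ⟨neg_le_neg hf.le, ?_, fun x hx => ?_⟩
  · exact hf.int.symm.comp_neg_left.neg
  · rw [intervalIntegral.integral_neg, intervalIntegral.integral_comp_neg f', neg_neg,
      ← hf.sub_eq ⟨by linarith [hx.2], by linarith [hx.1]⟩ (right_mem_Icc.2 hf.le)]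
    ring

end IsPrimitiveOn

/-- Iterated tail integrals of a nonnegative weight. -/
theorem integral_Ioi_mul_pow_le {ρ : ℝ → ℝ} {a : ℝ} (hρ : IntegrableOn ρ (Ioi a))
    (h0 : ∀ t ∈ Ioi a, 0 ≤ ρ t) (n : ℕ) :
    IntegrableOn (fun t => ρ t * (∫ s in Ioi t, ρ s) ^ n) (Ioi a) ∧
      ∫ t in Ioi a, ρ t * (∫ s in Ioi t, ρ s) ^ n ≤ (∫ s in Ioi a, ρ s) ^ (n + 1) / (n + 1) := by
  set P : ℝ → ℝ := fun x => ∫ s in Ioi x, ρ s with hP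
  have hprim : ∀ b, a ≤ b → IsPrimitiveOn P (fun x => -ρ x) a b := fun b hb =>
    IsPrimitiveOn.integral_Ioi hb hρ
  have hPnn : ∀ t, a ≤ t → 0 ≤ P t := fun t ht =>
    setIntegral_nonneg measurableSet_Ioi fun s hs => h0 s (lt_of_le_of_lt ht hs)
  have hPle : ∀ t, a ≤ t → P t ≤ P a := fun t ht =>
    setIntegral_mono_set hρ (ae_restrict_of_forall_mem measurableSet_Ioi h0)
      (Ioi_subset_Ioi ht).eventuallyLE
  have hPm : AEStronglyMeasurable P (volume.restrict (Ioi a)) := by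
    refine (ContinuousOn.aestronglyMeasurable (fun x hx => ?_) measurableSet_Ioi)
    have hx' : a < x := hx
    exact (((hprim (x + 1) (by linarith)).continuousOn x ⟨hx'.le, by linarith⟩).continuousAt
      (Icc_mem_nhds hx' (by linarith))).continuousWithinAt
  have hint : IntegrableOn (fun t => ρ t * P t ^ n) (Ioi a) := by
    refine Integrable.mono' (hρ.mul_const (P a ^ n)) (hρ.aestronglyMeasurable.mul (hPm.pow n)) ?_
    refine ae_restrict_of_forall_mem measurableSet_Ioi fun t ht => ?_
    have ht' : a ≤ t := le_of_lt ht
    rw [norm_mul, norm_pow, Real.norm_of_nonneg (h0 t ht), Real.norm_of_nonneg (hPnn t ht')]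
    exact mul_le_mul_of_nonneg_left (pow_le_pow_left₀ (hPnn t ht') (hPle t ht') n) (h0 t ht)
  refine ⟨hint, ?_⟩
  refine le_of_tendsto (intervalIntegral_tendsto_integral_Ioi a hint tendsto_id) ?_
  filter_upwards [eventually_ge_atTop a] with b hb
  -- The integrand is minus the derivative of `P ^ (n + 1) / (n + 1)`. This is the source of the
  -- factorials in the Neumann series.
  have h1 := ((hprim b hb).pow_succ n).sub_eq (left_mem_Icc.2 hb) (right_mem_Icc.2 hb)
  have h2 : ∫ t in a..b, ((n : ℝ) + 1) * (-ρ t * P t ^ n)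
      = -((n + 1) * ∫ t in a..b, ρ t * P t ^ n) := by
    rw [← intervalIntegral.integral_const_mul, ← intervalIntegral.integral_neg]
    exact intervalIntegral.integral_congr fun t _ => by ring
  rw [h2] at h1
  rw [le_div_iff₀ (by positivity)]
  have := pow_nonneg (hPnn b hb) (n + 1)
  simp only [id]
  linarith

/-- Grönwall's inequality with an integrable weight and zero initial value. -/
theorem eq_zero_of_le_integral {ρ N : ℝ → ℝ} {a b : ℝ} (hρ : IntervalIntegrable ρ volume a b)
    (h0 : ∀ t ∈ Icc a b, 0 ≤ ρ t) (hN : ContinuousOn N (Icc a b)) (hN0 : ∀ x ∈ Icc a b, 0 ≤ N x)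
    (h : ∀ x ∈ Icc a b, N x ≤ ∫ t in a..x, ρ t * N t) : ∀ x ∈ Icc a b, N x = 0 := by
  intro x hx
  have hab : a ≤ b := hx.1.trans hx.2
  obtain ⟨M, hM⟩ := isCompact_Icc.exists_bound_of_continuousOn hN
  set S : ℝ → ℝ := fun x => ∫ t in a..x, ρ t with hS
  have hprim : IsPrimitiveOn S ρ a b := ⟨hab, hρ, fun y _ => by simp [hS]⟩
  have ha : a ∈ Icc a b := left_mem_Icc.2 hab
  -- Feeding the inequality into itself `n` times gains `S ^ n / n!`, which tends to zero.
  have key : ∀ n : ℕ, ∀ y ∈ Icc a b, N y ≤ M * (S y ^ n / n.factorial) := by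
    intro n
    induction n with
    | zero => exact fun y hy => by simpa using (le_abs_self _).trans (hM y hy)
    | succ n ih =>
      intro y hy
      have hle : ∫ t in a..y, ρ t * N t
          ≤ ∫ t in a..y, M / (n + 1).factorial * ((n + 1) * (ρ t * S t ^ n)) := by
        refine intervalIntegral.integral_mono_on hy.1 ?_
          (((hprim.pow_succ n).intOn ha hy).const_mul _) fun t ht => ?_
        · exact (hprim.intOn ha hy).mul_continuousOn (by
            rw [uIcc_of_le hy.1]
            exact hN.mono (Icc_subset_Icc_right hy.2))
        · have ht' : t ∈ Icc a b := ⟨ht.1, ht.2.trans hy.2⟩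
          refine (mul_le_mul_of_nonneg_left (ih t ht') (h0 t ht')).trans_eq ?_
          rw [Nat.factorial_succ]
          push_cast
          field_simp
      refine (h y hy).trans (hle.trans_eq ?_)
      rw [intervalIntegral.integral_const_mul, ← (hprim.pow_succ n).sub_eq ha hy]
      simp [hS]
      ring
  have hlim : Tendsto (fun n : ℕ => M * (S x ^ n / n.factorial)) atTop (𝓝 (M * 0)) :=
    (FloorSemiring.tendsto_pow_div_factorial_atTop (S x)).const_mul M
  rw [mul_zero] at hlim
  exact le_antisymm (ge_of_tendsto' hlim fun n => key n x hx) (hN0 x hx)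

theorem eqZero_of_left_eq_zero {f g K : ℝ → ℂ} {a b : ℝ} (hf : IsPrimitiveOn f g a b)
    (hg : IsPrimitiveOn g (fun x => K x * f x) a b) (hK : IntervalIntegrable K volume a b)
    (hfa : f a = 0) (hga : g a = 0) : ∀ x ∈ Icc a b, f x = 0 ∧ g x = 0 := by
  have ha : a ∈ Icc a b := left_mem_Icc.2 hf.le
  have hN : ∀ x ∈ Icc a b, ‖f x‖ + ‖g x‖ = 0 := by
    refine eq_zero_of_le_integral (ρ := fun t => 1 + ‖K t‖) (intervalIntegrable_const.add hK.norm)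
      (fun t _ => by positivity) (hf.continuousOn.norm.add hg.continuousOn.norm)
      (fun x _ => by positivity) fun x hx => ?_
    have h1 : ‖f x‖ ≤ ∫ t in a..x, ‖g t‖ := by
      rw [hf.eq x hx, hfa, zero_add]
      exact intervalIntegral.norm_integral_le_integral_norm hx.1
    have h2 : ‖g x‖ ≤ ∫ t in a..x, ‖K t * f t‖ := by
      rw [hg.eq x hx, hga, zero_add]
      exact intervalIntegral.norm_integral_le_integral_norm hx.1
    refine (add_le_add h1 h2).trans ?_
    rw [← intervalIntegral.integral_add (hf.intOn ha hx).norm (hg.intOn ha hx).norm]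
    refine intervalIntegral.integral_mono_on hx.1
      ((hf.intOn ha hx).norm.add (hg.intOn ha hx).norm) ?_ fun t ht => ?_
    · refine IntervalIntegrable.mul_continuousOn (intervalIntegrable_const.add
        (hK.norm.mono_set ?_)) ?_
      · rw [uIcc_of_le hf.le, uIcc_of_le hx.1]
        exact Icc_subset_Icc_right hx.2
      · rw [uIcc_of_le hx.1]
        exact (hf.continuousOn.norm.add hg.continuousOn.norm).mono (Icc_subset_Icc_right hx.2)
    · rw [norm_mul]
      nlinarith [norm_nonneg (f t), norm_nonneg (g t), norm_nonneg (K t),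
        mul_nonneg (norm_nonneg (K t)) (norm_nonneg (g t))]
  intro x hx
  have := hN x hx
  constructor
  · exact norm_le_zero_iff.1 (by linarith [norm_nonneg (g x)])
  · exact norm_le_zero_iff.1 (by linarith [norm_nonneg (f x)])

/-- Uniqueness for the Cauchy problem `f'' = K f` with integrable `K`. -/
theorem eqZero_of_cauchyData_eq_zero {f g K : ℝ → ℂ} {a b c : ℝ} (hf : IsPrimitiveOn f g a b)
    (hg : IsPrimitiveOn g (fun x => K x * f x) a b) (hK : IntervalIntegrable K volume a b)
    (hc : c ∈ Icc a b) (hfc : f c = 0) (hgc : g c = 0) : ∀ x ∈ Icc a b, f x = 0 ∧ g x = 0 := by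
  intro x hx
  rcases le_total c x with hcx | hxc
  · exact eqZero_of_left_eq_zero (hf.mono hc.1 hc.2 le_rfl) (hg.mono hc.1 hc.2 le_rfl)
      (hK.mono_set (by rw [uIcc_of_le hf.le, uIcc_of_le hc.2]; exact Icc_subset_Icc_left hc.1))
      hfc hgc x ⟨hcx, hx.2⟩
  · have hf' := (hf.mono le_rfl hc.1 hc.2).comp_neg
    have hg' := (hg.mono le_rfl hc.1 hc.2).comp_neg.neg
    have hK' : IntervalIntegrable K volume c a := (hK.mono_set (by
      rw [uIcc_of_le hf.le, uIcc_of_le hc.1]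
      exact Icc_subset_Icc_right hc.2)).symm
    have := eqZero_of_left_eq_zero (K := fun x => K (-x)) hf'
      (hg'.congr_deriv fun x _ => by simp) hK'.comp_neg_left (by simpa) (by simpa) (-x)
      ⟨neg_le_neg hxc, neg_le_neg hx.1⟩
    simpa using this

end Primitive

/-- A dominated integral of holomorphic functions is holomorphic. -/
theorem differentiableOn_integral_of_dominated {α : Type*} [MeasurableSpace α] {μ : Measure α}
    {U : Set ℂ} (hU : IsOpen U) {F : ℂ → α → ℂ} {bound : α → ℝ}
    (hm : ∀ k ∈ U, AEStronglyMeasurable (F k) μ)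
    (hb : ∀ᵐ a ∂μ, ∀ k ∈ U, ‖F k a‖ ≤ bound a) (hbi : Integrable bound μ)
    (hd : ∀ᵐ a ∂μ, DifferentiableOn ℂ (F · a) U) :
    DifferentiableOn ℂ (fun k => ∫ a, F k a ∂μ) U := by
  intro k hk
  obtain ⟨ε, hε, hball⟩ := Metric.isOpen_iff.1 hU k hk
  have hmem : ∀ x ∈ Metric.ball k (ε / 2), Metric.ball x (ε / 2) ⊆ U := fun x hx y hy =>
    hball (by
      rw [Metric.mem_ball] at *
      linarith [dist_triangle y x k])
  have hderiv : ∀ᵐ a ∂μ, ∀ x ∈ Metric.ball k (ε / 2), HasDerivAt (F · a) (deriv (F · a) x) x := by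
    filter_upwards [hd] with a ha x hx
    have hxU : x ∈ U := hmem x hx (Metric.mem_ball_self (by linarith))
    exact ((ha x hxU).differentiableAt (hU.mem_nhds hxU)).hasDerivAt
  refine (hasDerivAt_integral_of_dominated_loc_of_deriv_le (F := F) (x₀ := k)
    (F' := fun k a => deriv (F · a) k) (bound := fun a => bound a / (ε / 4))
    (Metric.ball_mem_nhds k (half_pos hε)) ?_ ?_ ?_ ?_ (hbi.div_const _)
    hderiv).2.differentiableAt.differentiableWithinAt
  · filter_upwards [hU.mem_nhds hk] with x hx using hm x hx
  · exact hbi.mono' (hm k hk) (hb.mono fun a ha => ha k hk)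
  -- Measurability of the derivative in the integration variable: it is the limit of difference
  -- quotients along a sequence of steps that stay in the ball.
  · set s : ℕ → ℂ := fun n => ((ε / 2 / (n + 1) : ℝ) : ℂ) with hs
    have hs0 : Tendsto s atTop (𝓝 0) := by
      have : Tendsto (fun n : ℕ => ε / 2 / ((n : ℝ) + 1)) atTop (𝓝 0) :=
        tendsto_const_nhds.div_atTop (tendsto_atTop_add_const_right _ _ tendsto_natCast_atTop_atTop)
      have h2 := (Complex.continuous_ofReal.tendsto 0).comp this
      rwa [Complex.ofReal_zero] at h2
    have hsne : ∀ n, s n ≠ 0 := fun n => by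
      simp only [hs, ne_eq, Complex.ofReal_eq_zero]
      positivity
    have hsU : ∀ n, k + s n ∈ U := fun n => hball (by
      simp only [Metric.mem_ball, dist_self_add_left, hs, Complex.norm_real]
      rw [Real.norm_of_nonneg (by positivity)]
      refine (div_le_self (by positivity) (by linarith [n.cast_nonneg (α := ℝ)])).trans_lt
        (by linarith))
    refine aestronglyMeasurable_of_tendsto_ae (u := atTop)
      (f := fun n a => (s n)⁻¹ * (F (k + s n) a - F k a))
      (fun n => ((hm _ (hsU n)).sub (hm k hk)).const_mul _) ?_
    filter_upwards [hderiv] with a ha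
    have h1 := (hasDerivAt_iff_tendsto_slope_zero.1 (ha k (Metric.mem_ball_self (half_pos hε))))
    have h2 : Tendsto s atTop (𝓝[≠] 0) :=
      tendsto_nhdsWithin_iff.2 ⟨hs0, Eventually.of_forall hsne⟩
    exact h1.comp h2
  -- Cauchy's estimate on circles of radius `ε / 4` bounds the derivative by the same majorant, up
  -- to a constant.
  · filter_upwards [hb, hd] with a ha hda x hx
    refine Complex.norm_deriv_le_of_forall_mem_sphere_norm_le (by linarith) ?_ fun y hy => ha y ?_
    · refine DifferentiableOn.diffContOnCl (hda.mono ?_)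
      refine Metric.closure_ball_subset_closedBall.trans ?_
      exact (Metric.closedBall_subset_ball (by linarith)).trans (hmem x hx)
    · exact hmem x hx (Metric.sphere_subset_closedBall.trans
        (Metric.closedBall_subset_ball (by linarith)) hy)

/-! ### The Volterra equation on the half-line -/

/-- The function `V` and its first moment are integrable against `exp (2 η t)`. -/
structure ExpDecay (V : ℝ → ℂ) (η : ℝ) : Prop where
  nonneg : 0 ≤ η
  meas : AEStronglyMeasurable V (volume.restrict (Ioi 0))
  int : IntegrableOn (fun t => Real.exp (2 * η * t) * (1 + t) * ‖V t‖) (Ioi 0)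

/-- The kernel `∫₀ˢ exp (2 i k τ) dτ`. -/
noncomputable def phaseInt (k : ℂ) (s : ℝ) : ℂ :=
  ∫ τ in (0 : ℝ)..s, Complex.exp (2 * Complex.I * k * τ)

theorem phaseInt_hasDerivAt (k : ℂ) (s : ℝ) :
    HasDerivAt (phaseInt k) (Complex.exp (2 * Complex.I * k * s)) s := by
  have hc : Continuous fun τ : ℝ => Complex.exp (2 * Complex.I * k * τ) := by fun_prop
  exact intervalIntegral.integral_hasDerivAt_right (hc.intervalIntegrable _ _)
    (hc.stronglyMeasurableAtFilter _ _) hc.continuousAt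

theorem phaseInt_continuous (k : ℂ) : Continuous (phaseInt k) :=
  continuous_iff_continuousAt.2 fun s => (phaseInt_hasDerivAt k s).continuousAt

theorem mul_phaseInt (k : ℂ) (s : ℝ) :
    2 * Complex.I * k * phaseInt k s = Complex.exp (2 * Complex.I * k * s) - 1 := by
  rcases eq_or_ne k 0 with rfl | hk
  · simp
  · have hc : 2 * Complex.I * k ≠ 0 := by simp [hk]
    rw [phaseInt, integral_exp_mul_complex hc]
    field_simp
    simp

/-- Separates the variables `x` and `t`, so that the Volterra integral can be differentiated in `x`
by the product rule alone. -/
theorem phaseInt_sub (k : ℂ) (x t : ℝ) :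
    phaseInt k (t - x) = Complex.exp (-(2 * Complex.I * k * x)) * (phaseInt k t - phaseInt k x) := by
  have hc : Continuous fun τ : ℝ => Complex.exp (2 * Complex.I * k * τ) := by fun_prop
  have h1 : phaseInt k t - phaseInt k x = ∫ τ in x..t, Complex.exp (2 * Complex.I * k * τ) :=
    intervalIntegral.integral_interval_sub_left (hc.intervalIntegrable _ _)
      (hc.intervalIntegrable _ _)
  have h2 := intervalIntegral.integral_comp_add_right (a := 0) (b := t - x)
    (fun τ : ℝ => Complex.exp (2 * Complex.I * k * τ)) x
  rw [zero_add, sub_add_cancel] at h2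
  rw [h1, ← h2, phaseInt, ← intervalIntegral.integral_const_mul]
  refine intervalIntegral.integral_congr fun τ _ => ?_
  rw [← Complex.exp_add]
  congr 1
  push_cast
  ring

theorem norm_exp_two_I_mul (k : ℂ) (s : ℝ) :
    ‖Complex.exp (2 * Complex.I * k * s)‖ = Real.exp (-(2 * k.im * s)) := by
  rw [Complex.norm_exp]
  congr 1
  simp [mul_assoc]

theorem norm_exp_I_mul (k : ℂ) (s : ℝ) :
    ‖Complex.exp (Complex.I * k * s)‖ = Real.exp (-(k.im * s)) := by
  rw [Complex.norm_exp]
  congr 1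
  simp [mul_assoc]

theorem norm_exp_two_I_mul_le {k : ℂ} {η s : ℝ} (hk : -η ≤ k.im) (hs : 0 ≤ s) :
    ‖Complex.exp (2 * Complex.I * k * s)‖ ≤ Real.exp (2 * η * s) := by
  rw [norm_exp_two_I_mul]
  gcongr
  nlinarith

/-- A bound uniform in `k`, including `k = 0`, at the price of a factor `s`. Its counterpart
`norm_mul_phaseInt_le` has no such factor but degenerates as `k → 0`. They lead to the exponents CR²
and CR/|k| respectively. -/
theorem norm_phaseInt_le {k : ℂ} {η s : ℝ} (hη : 0 ≤ η) (hk : -η ≤ k.im) (hs : 0 ≤ s) :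
    ‖phaseInt k s‖ ≤ s * Real.exp (2 * η * s) := by
  have := intervalIntegral.norm_integral_le_of_norm_le_const (a := 0) (b := s)
    (f := fun τ : ℝ => Complex.exp (2 * Complex.I * k * τ)) (C := Real.exp (2 * η * s))
    fun τ hτ => by
      rw [uIoc_of_le hs] at hτ
      refine (norm_exp_two_I_mul_le hk hτ.1.le).trans ?_
      gcongr
      exact hτ.2
  rw [sub_zero, abs_of_nonneg hs] at this
  exact this.trans_eq (mul_comm _ _)

theorem norm_mul_phaseInt_le {k : ℂ} {η s : ℝ} (hη : 0 ≤ η) (hk : -η ≤ k.im) (hs : 0 ≤ s) :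
    ‖k‖ * ‖phaseInt k s‖ ≤ Real.exp (2 * η * s) := by
  have h1 := congrArg norm (mul_phaseInt k s)
  rw [norm_mul, norm_mul, norm_mul, Complex.norm_I, Complex.norm_ofNat] at h1
  have h2 := norm_sub_le (Complex.exp (2 * Complex.I * k * s)) 1
  have h3 := norm_exp_two_I_mul_le hk hs
  have h4 : 1 ≤ Real.exp (2 * η * s) := Real.one_le_exp (by positivity)
  rw [norm_one] at h2
  linarith

theorem isOpen_im_gt (c : ℝ) : IsOpen {k : ℂ | c < k.im} :=
  isOpen_lt continuous_const Complex.continuous_im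

theorem phaseInt_differentiableOn {η s : ℝ} (hη : 0 ≤ η) (hs : 0 ≤ s) :
    DifferentiableOn ℂ (fun k => phaseInt k s) {k | -η < k.im} := by
  simp only [phaseInt, intervalIntegral.integral_of_le hs]
  refine differentiableOn_integral_of_dominated (isOpen_im_gt _)
    (bound := fun _ => Real.exp (2 * η * s)) (fun k _ => ?_) ?_ ?_ ?_
  · exact Continuous.aestronglyMeasurable (by fun_prop)
  · refine ae_restrict_of_forall_mem measurableSet_Ioc fun τ hτ k hk => ?_
    refine (norm_exp_two_I_mul_le (le_of_lt hk) hτ.1.le).trans ?_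
    gcongr
    exact hτ.2
  · exact integrable_const _
  · exact Eventually.of_forall fun τ => Differentiable.differentiableOn (by fun_prop)

/-- The Volterra operator `h ↦ ∫ₓ^∞ D_k(t - x) h(t) dt`. -/
noncomputable def volterra (k : ℂ) (h : ℝ → ℂ) (x : ℝ) : ℂ :=
  ∫ t in Ioi x, phaseInt k (t - x) * h t

namespace ExpDecay

variable {V h : ℝ → ℂ} {η : ℝ} {k : ℂ}

theorem weight_nonneg (η : ℝ) (V : ℝ → ℂ) {t : ℝ} (ht : 0 < t) :
    0 ≤ Real.exp (2 * η * t) * (1 + t) * ‖V t‖ := by positivity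

theorem norm_le (hV : ExpDecay V η) {t : ℝ} (ht : 0 < t) :
    ‖V t‖ ≤ Real.exp (2 * η * t) * (1 + t) * ‖V t‖ := by
  have h1 : 1 ≤ Real.exp (2 * η * t) := Real.one_le_exp (by have := hV.nonneg; positivity)
  exact le_mul_of_one_le_left (norm_nonneg _) (by nlinarith)

theorem integrableOn (hV : ExpDecay V η) : IntegrableOn V (Ioi 0) :=
  Integrable.mono' hV.int hV.meas
    (ae_restrict_of_forall_mem measurableSet_Ioi fun _ ht => hV.norm_le ht)

theorem phaseInt_weight (hV : ExpDecay V η) (hk : -η ≤ k.im) {x t : ℝ} (hx : 0 ≤ x) (hxt : x < t) :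
    ‖phaseInt k (t - x)‖ * ‖V t‖ ≤ Real.exp (2 * η * t) * (1 + t) * ‖V t‖ := by
  refine mul_le_mul_of_nonneg_right ?_ (norm_nonneg _)
  refine (norm_phaseInt_le hV.nonneg hk (by linarith)).trans ?_
  rw [mul_comm]
  have := hV.nonneg
  gcongr <;> linarith

theorem mul_bounded (hV : ExpDecay V η) {m : ℝ → ℂ} (hm : ContinuousOn m (Ici 0)) {C : ℝ}
    (hC : ∀ x, 0 ≤ x → ‖m x‖ ≤ C) : ExpDecay (fun t => V t * m t) η := by
  have hmm : AEStronglyMeasurable m (volume.restrict (Ioi 0)) :=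
    (hm.mono Ioi_subset_Ici_self).aestronglyMeasurable measurableSet_Ioi
  refine ⟨hV.nonneg, hV.meas.mul hmm, ?_⟩
  refine Integrable.mono' (hV.int.mul_const C) ?_ ?_
  · refine AEStronglyMeasurable.mul ?_ (hV.meas.mul hmm).norm
    exact Continuous.aestronglyMeasurable (by fun_prop)
  · refine ae_restrict_of_forall_mem measurableSet_Ioi fun t ht => ?_
    have ht' : (0 : ℝ) < t := ht
    rw [Real.norm_of_nonneg (weight_nonneg η (fun t => V t * m t) ht), norm_mul, ← mul_assoc]
    exact mul_le_mul_of_nonneg_left (hC t ht'.le) (weight_nonneg η V ht)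

theorem integrableOn_phaseInt_mul (hh : ExpDecay h η) (hk : -η ≤ k.im) {x : ℝ} (hx : 0 ≤ x) :
    IntegrableOn (fun t => phaseInt k (t - x) * h t) (Ioi x) := by
  refine Integrable.mono' (hh.int.mono_set (Ioi_subset_Ioi hx))
    (AEStronglyMeasurable.mul ?_ (hh.meas.mono_set (Ioi_subset_Ioi hx))) ?_
  · exact ((phaseInt_continuous k).comp (by fun_prop)).aestronglyMeasurable
  · refine ae_restrict_of_forall_mem measurableSet_Ioi fun t ht => ?_
    rw [norm_mul]
    exact hh.phaseInt_weight hk hx ht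

theorem tail_isPrimitiveOn (hh : ExpDecay h η) {b : ℝ} (hb : 0 ≤ b) :
    IsPrimitiveOn (fun x => ∫ t in Ioi x, h t) (fun x => -h x) 0 b :=
  IsPrimitiveOn.integral_Ioi hb hh.integrableOn

theorem volterra_isPrimitiveOn (hh : ExpDecay h η) (hk : -η ≤ k.im) {b : ℝ} (hb : 0 ≤ b) :
    IsPrimitiveOn (volterra k h)
      (fun x => -((∫ t in Ioi x, h t) + 2 * Complex.I * k * volterra k h x)) 0 b := by
  have hD : IntegrableOn (fun t => phaseInt k t * h t) (Ioi 0) := by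
    simpa using hh.integrableOn_phaseInt_mul hk le_rfl
  have key : ∀ x : ℝ, 0 ≤ x → Complex.exp (-(2 * Complex.I * k * x)) *
      ((∫ t in Ioi x, phaseInt k t * h t) - phaseInt k x * ∫ t in Ioi x, h t)
      = volterra k h x := by
    intro x hx
    have hs := Ioi_subset_Ioi hx
    rw [← integral_const_mul, ← integral_sub (hD.mono_set hs)
      ((hh.integrableOn.mono_set hs).const_mul _), ← integral_const_mul, volterra]
    refine integral_congr_ae (Eventually.of_forall fun t => ?_)
    simp only [phaseInt_sub]
    ring
  have he : IsPrimitiveOn (fun x : ℝ => Complex.exp (-(2 * Complex.I * k * x)))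
      (fun x : ℝ => -(2 * Complex.I * k) * Complex.exp (-(2 * Complex.I * k * x))) 0 b := by
    refine IsPrimitiveOn.of_hasDerivAt hb (fun x => ?_) (by fun_prop)
    have h1 : HasDerivAt (fun x : ℝ => -(2 * Complex.I * k * (x : ℂ))) (-(2 * Complex.I * k)) x := by
      simpa using ((Complex.ofRealCLM.hasDerivAt (x := x)).const_mul (2 * Complex.I * k)).fun_neg
    exact h1.cexp.congr_deriv (mul_comm _ _)
  have hp : IsPrimitiveOn (phaseInt k) (fun s : ℝ => Complex.exp (2 * Complex.I * k * s)) 0 b :=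
    IsPrimitiveOn.of_hasDerivAt hb (phaseInt_hasDerivAt k) (by fun_prop)
  refine ((he.mul ((IsPrimitiveOn.integral_Ioi hb hD).sub
    (hp.mul (hh.tail_isPrimitiveOn hb)))).congr_deriv fun x hx => ?_).congr fun x hx => key x hx.1
  rw [← key x hx.1]
  have h1 : Complex.exp (-(2 * Complex.I * k * x)) * Complex.exp (2 * Complex.I * k * x) = 1 := by
    rw [← Complex.exp_add]
    simp
  linear_combination (-∫ t in Ioi x, h t) * h1

end ExpDecay

theorem continuousOn_Ici_of_isPrimitiveOn {f f' : ℝ → ℂ}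
    (h : ∀ b, 0 ≤ b → IsPrimitiveOn f f' 0 b) : ContinuousOn f (Ici 0) := by
  intro x hx
  have hx' : (0 : ℝ) ≤ x := hx
  have h1 := (h (x + 1) (by linarith)).continuousOn x ⟨hx', by linarith⟩
  refine h1.mono_of_mem_nhdsWithin ?_
  rw [← Ici_inter_Iic]
  exact inter_mem self_mem_nhdsWithin (mem_nhdsWithin_of_mem_nhds (Iic_mem_nhds (by linarith)))

/-! ### The Jost solution -/

/-- The terms of the Neumann series of the Volterra equation for `exp (-ikx)` times the Jost
solution. -/
noncomputable def jostTerm (V : ℝ → ℂ) (k : ℂ) : ℕ → ℝ → ℂ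
  | 0 => fun _ => 1
  | n + 1 => volterra k fun t => V t * jostTerm V k n t

/-- The Jost solution divided by `exp (ikx)`. -/
noncomputable def jostM (V : ℝ → ℂ) (k : ℂ) (x : ℝ) : ℂ := ∑' n, jostTerm V k n x

/-- An integrable majorant of the Volterra kernel. -/
structure IsJostWeight (V : ℝ → ℂ) (k : ℂ) (ρ : ℝ → ℝ) : Prop where
  int : IntegrableOn ρ (Ioi 0)
  le : ∀ x t, 0 ≤ x → x < t → ‖phaseInt k (t - x)‖ * ‖V t‖ ≤ ρ t

namespace IsJostWeight

variable {V : ℝ → ℂ} {η : ℝ} {k : ℂ} {ρ : ℝ → ℝ}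

theorem nonneg (hρ : IsJostWeight V k ρ) {t : ℝ} (ht : 0 < t) : 0 ≤ ρ t :=
  le_trans (by positivity) (hρ.le 0 t le_rfl ht)

theorem tail_nonneg (hρ : IsJostWeight V k ρ) {x : ℝ} (hx : 0 ≤ x) : 0 ≤ ∫ t in Ioi x, ρ t :=
  setIntegral_nonneg measurableSet_Ioi fun _ ht => hρ.nonneg (hx.trans_lt ht)

theorem tail_le (hρ : IsJostWeight V k ρ) {x : ℝ} (hx : 0 ≤ x) :
    ∫ t in Ioi x, ρ t ≤ ∫ t in Ioi 0, ρ t :=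
  setIntegral_mono_set hρ.int
    (ae_restrict_of_forall_mem measurableSet_Ioi fun _ ht => hρ.nonneg ht)
    (Ioi_subset_Ioi hx).eventuallyLE

theorem jostTerm_bound (hρ : IsJostWeight V k ρ) (hV : ExpDecay V η) (hk : -η ≤ k.im) (n : ℕ) :
    ContinuousOn (jostTerm V k n) (Ici 0) ∧
      ∀ x, 0 ≤ x → ‖jostTerm V k n x‖ ≤ (∫ t in Ioi x, ρ t) ^ n / n.factorial := by
  induction n with
  | zero => exact ⟨continuousOn_const, fun x _ => by simp [jostTerm]⟩
  | succ n ih =>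
    have hb : ExpDecay (fun t => V t * jostTerm V k n t) η :=
      hV.mul_bounded ih.1 (C := (∫ t in Ioi 0, ρ t) ^ n / n.factorial) fun x hx =>
        (ih.2 x hx).trans (div_le_div_of_nonneg_right
          (pow_le_pow_left₀ (hρ.tail_nonneg hx) (hρ.tail_le hx) n) (Nat.cast_nonneg _))
    refine ⟨continuousOn_Ici_of_isPrimitiveOn fun b hb' => hb.volterra_isPrimitiveOn hk hb',
      fun x hx => ?_⟩
    obtain ⟨h1, h2⟩ := integral_Ioi_mul_pow_le (hρ.int.mono_set (Ioi_subset_Ioi hx))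
      (fun t ht => hρ.nonneg (hx.trans_lt ht)) n
    calc ‖jostTerm V k (n + 1) x‖
        ≤ ∫ t in Ioi x, ρ t * (∫ s in Ioi t, ρ s) ^ n / n.factorial := by
          refine norm_integral_le_of_norm_le (h1.div_const _)
            (ae_restrict_of_forall_mem measurableSet_Ioi fun t ht => ?_)
          have ht' : 0 ≤ t := hx.trans (le_of_lt ht)
          rw [norm_mul, norm_mul, ← mul_assoc, mul_div_assoc]
          exact mul_le_mul (hρ.le x t hx ht) (ih.2 t ht') (norm_nonneg _)
            (hρ.nonneg (hx.trans_lt ht))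
      _ ≤ (∫ s in Ioi x, ρ s) ^ (n + 1) / (n + 1) / n.factorial := by
          rw [integral_div]
          gcongr
      _ = _ := by
          rw [Nat.factorial_succ, div_div]
          push_cast
          rfl

theorem jostTerm_norm_le (hρ : IsJostWeight V k ρ) (hV : ExpDecay V η) (hk : -η ≤ k.im) (n : ℕ)
    {x : ℝ} (hx : 0 ≤ x) : ‖jostTerm V k n x‖ ≤ (∫ t in Ioi 0, ρ t) ^ n / n.factorial :=
  ((hρ.jostTerm_bound hV hk n).2 x hx).trans (div_le_div_of_nonneg_right
    (pow_le_pow_left₀ (hρ.tail_nonneg hx) (hρ.tail_le hx) n) (Nat.cast_nonneg _))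

theorem jostTerm_summable (hρ : IsJostWeight V k ρ) (hV : ExpDecay V η) (hk : -η ≤ k.im)
    {x : ℝ} (hx : 0 ≤ x) : Summable fun n => jostTerm V k n x :=
  Summable.of_norm_bounded (Real.summable_pow_div_factorial _)
    fun n => (hρ.jostTerm_bound hV hk n).2 x hx

theorem hasSum_exp (y : ℝ) : HasSum (fun n : ℕ => y ^ n / n.factorial) (Real.exp y) := by
  rw [Real.exp_eq_exp_ℝ]
  exact NormedSpace.expSeries_div_hasSum_exp y

theorem norm_jostM_le (hρ : IsJostWeight V k ρ) (hV : ExpDecay V η) (hk : -η ≤ k.im)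
    {x : ℝ} (hx : 0 ≤ x) : ‖jostM V k x‖ ≤ Real.exp (∫ t in Ioi x, ρ t) :=
  tsum_of_norm_bounded (hasSum_exp _) fun n => (hρ.jostTerm_bound hV hk n).2 x hx

theorem norm_jostM_sub_one_le (hρ : IsJostWeight V k ρ) (hV : ExpDecay V η) (hk : -η ≤ k.im)
    {x : ℝ} (hx : 0 ≤ x) : ‖jostM V k x - 1‖ ≤ Real.exp (∫ t in Ioi x, ρ t) - 1 := by
  have h1 : jostM V k x - 1 = ∑' n, jostTerm V k (n + 1) x := by
    rw [jostM, (hρ.jostTerm_summable hV hk hx).tsum_eq_zero_add]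
    simp [jostTerm]
  have h2 := (hasSum_nat_add_iff' 1).2 (hasSum_exp (∫ t in Ioi x, ρ t))
  simp only [Finset.range_one, Finset.sum_singleton, pow_zero, Nat.factorial_zero, Nat.cast_one,
    div_one] at h2
  rw [h1]
  exact tsum_of_norm_bounded h2 fun n => (hρ.jostTerm_bound hV hk (n + 1)).2 x hx

end IsJostWeight

/-! ### The Volterra equation for the Jost solution and its analyticity in the spectral parameter.
-/

namespace ExpDecay

variable {V : ℝ → ℂ} {η : ℝ} {k : ℂ}

theorem isJostWeight (hV : ExpDecay V η) (hk : -η ≤ k.im) :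
    IsJostWeight V k fun t => Real.exp (2 * η * t) * (1 + t) * ‖V t‖ :=
  ⟨hV.int, fun _ _ hx hxt => hV.phaseInt_weight hk hx hxt⟩

/-- A bound for the Jost solution that is uniform in `k`. -/
noncomputable def jostBound (V : ℝ → ℂ) (η : ℝ) : ℝ :=
  Real.exp (∫ t in Ioi 0, Real.exp (2 * η * t) * (1 + t) * ‖V t‖)

theorem norm_jostM_le (hV : ExpDecay V η) (hk : -η ≤ k.im) {x : ℝ} (hx : 0 ≤ x) :
    ‖jostM V k x‖ ≤ jostBound V η :=
  ((hV.isJostWeight hk).norm_jostM_le hV hk hx).trans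
    (Real.exp_le_exp.2 ((hV.isJostWeight hk).tail_le hx))

theorem jostM_continuousOn (hV : ExpDecay V η) (hk : -η ≤ k.im) :
    ContinuousOn (jostM V k) (Ici 0) :=
  continuousOn_tsum (fun n => ((hV.isJostWeight hk).jostTerm_bound hV hk n).1)
    (Real.summable_pow_div_factorial _)
    fun n _ hx => (hV.isJostWeight hk).jostTerm_norm_le hV hk n hx

theorem mul_jostM (hV : ExpDecay V η) (hk : -η ≤ k.im) :
    ExpDecay (fun t => V t * jostM V k t) η :=
  hV.mul_bounded (hV.jostM_continuousOn hk) fun _ hx => hV.norm_jostM_le hk hx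

/-- The Neumann series is summed under the integral sign; dominated convergence applies because the
majorants of its terms sum to an exponential. -/
theorem jostM_eq (hV : ExpDecay V η) (hk : -η ≤ k.im) {x : ℝ} (hx : 0 ≤ x) :
    jostM V k x = 1 + volterra k (fun t => V t * jostM V k t) x := by
  have hρ := hV.isJostWeight hk
  set ρ : ℝ → ℝ := fun t => Real.exp (2 * η * t) * (1 + t) * ‖V t‖
  rw [jostM, (hρ.jostTerm_summable hV hk hx).tsum_eq_zero_add]
  have hmeas : ∀ n, AEStronglyMeasurable (fun t => phaseInt k (t - x) * (V t * jostTerm V k n t))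
      (volume.restrict (Ioi x)) := fun n => by
    refine AEStronglyMeasurable.mul
      ((phaseInt_continuous k).comp (by fun_prop)).aestronglyMeasurable
      (AEStronglyMeasurable.mul (hV.meas.mono_set (Ioi_subset_Ioi hx)) ?_)
    exact ((hρ.jostTerm_bound hV hk n).1.mono (fun t ht => hx.trans (le_of_lt ht))
      ).aestronglyMeasurable measurableSet_Ioi
  have h := hasSum_integral_of_dominated_convergence (μ := volume.restrict (Ioi x))
    (F := fun n t => phaseInt k (t - x) * (V t * jostTerm V k n t))
    (f := fun t => phaseInt k (t - x) * (V t * jostM V k t))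
    (fun n t => ρ t * ((∫ t in Ioi 0, ρ t) ^ n / n.factorial)) hmeas
    (fun n => ae_restrict_of_forall_mem measurableSet_Ioi fun t ht => by
      rw [norm_mul, norm_mul, ← mul_assoc]
      exact mul_le_mul (hρ.le x t hx ht)
        (hρ.jostTerm_norm_le hV hk n (hx.trans (le_of_lt ht))) (norm_nonneg _)
        (hρ.nonneg (hx.trans_lt ht)))
    (Eventually.of_forall fun t => (Real.summable_pow_div_factorial _).mul_left _)
    (by
      simp_rw [tsum_mul_left]
      exact (hρ.int.mono_set (Ioi_subset_Ioi hx)).mul_const _)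
    (ae_restrict_of_forall_mem measurableSet_Ioi fun t ht =>
      ((hρ.jostTerm_summable hV hk (hx.trans (le_of_lt ht))).hasSum.mul_left _).mul_left _)
  have h' : ∑' n, jostTerm V k (n + 1) x = volterra k (fun t => V t * jostM V k t) x := h.tsum_eq
  rw [h']
  simp [jostTerm]

theorem jostTerm_differentiableOn (hV : ExpDecay V η) (n : ℕ) {x : ℝ} (hx : 0 ≤ x) :
    DifferentiableOn ℂ (fun k => jostTerm V k n x) {k | -η < k.im} := by
  induction n generalizing x with
  | zero => exact differentiableOn_const _
  | succ n ih =>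
    simp only [jostTerm, volterra]
    set ρ : ℝ → ℝ := fun t => Real.exp (2 * η * t) * (1 + t) * ‖V t‖
    refine differentiableOn_integral_of_dominated (isOpen_im_gt _)
      (bound := fun t => ρ t * ((∫ t in Ioi 0, ρ t) ^ n / n.factorial)) (fun k hk => ?_) ?_ ?_ ?_
    · refine AEStronglyMeasurable.mul
        ((phaseInt_continuous k).comp (by fun_prop)).aestronglyMeasurable
        (AEStronglyMeasurable.mul (hV.meas.mono_set (Ioi_subset_Ioi hx)) ?_)
      exact (((hV.isJostWeight (le_of_lt hk)).jostTerm_bound hV (le_of_lt hk) n).1.mono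
        (fun t ht => hx.trans (le_of_lt ht))).aestronglyMeasurable measurableSet_Ioi
    · refine ae_restrict_of_forall_mem measurableSet_Ioi fun t ht k hk => ?_
      have hρ := hV.isJostWeight (le_of_lt hk)
      rw [norm_mul, norm_mul, ← mul_assoc]
      exact mul_le_mul (hρ.le x t hx ht)
        (hρ.jostTerm_norm_le hV (le_of_lt hk) n (hx.trans (le_of_lt ht))) (norm_nonneg _)
        (hρ.nonneg (hx.trans_lt ht))
    · exact (hV.int.mono_set (Ioi_subset_Ioi hx)).mul_const _
    · refine ae_restrict_of_forall_mem measurableSet_Ioi fun t ht => ?_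
      exact (phaseInt_differentiableOn hV.nonneg (by linarith [mem_Ioi.1 ht])).mul
        ((differentiableOn_const _).mul (ih (hx.trans (le_of_lt ht))))

theorem jostM_differentiableOn (hV : ExpDecay V η) {x : ℝ} (hx : 0 ≤ x) :
    DifferentiableOn ℂ (fun k => jostM V k x) {k | -η < k.im} :=
  Complex.differentiableOn_tsum_of_summable_norm (Real.summable_pow_div_factorial _)
    (fun n => hV.jostTerm_differentiableOn n hx) (isOpen_im_gt _)
    fun n _ hk => (hV.isJostWeight (le_of_lt hk)).jostTerm_norm_le hV (le_of_lt hk) n hx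

end ExpDecay

/-- Minus the derivative of `jostM V k`. -/
noncomputable def jostP (V : ℝ → ℂ) (k : ℂ) (x : ℝ) : ℂ :=
  (∫ t in Ioi x, V t * jostM V k t) + 2 * Complex.I * k * volterra k (fun t => V t * jostM V k t) x

/-- The Jost solution: the solution of `-ψ'' + V ψ = k² ψ` asymptotic to `exp (ikx)`. -/
noncomputable def jost (V : ℝ → ℂ) (k : ℂ) (x : ℝ) : ℂ :=
  Complex.exp (Complex.I * k * x) * jostM V k x

/-- The derivative of the Jost solution. -/
noncomputable def jostDeriv (V : ℝ → ℂ) (k : ℂ) (x : ℝ) : ℂ :=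
  Complex.exp (Complex.I * k * x) * (Complex.I * k * jostM V k x - jostP V k x)

theorem isPrimitiveOn_exp_I_mul (k : ℂ) {a b : ℝ} (hb : a ≤ b) :
    IsPrimitiveOn (fun x : ℝ => Complex.exp (Complex.I * k * x))
      (fun x : ℝ => Complex.I * k * Complex.exp (Complex.I * k * x)) a b := by
  refine IsPrimitiveOn.of_hasDerivAt hb (fun x => ?_) (by fun_prop)
  have h1 : HasDerivAt (fun x : ℝ => Complex.I * k * (x : ℂ)) (Complex.I * k) x := by
    simpa using (Complex.ofRealCLM.hasDerivAt (x := x)).const_mul (Complex.I * k)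
  exact h1.cexp.congr_deriv (mul_comm _ _)

namespace ExpDecay

variable {V : ℝ → ℂ} {η : ℝ} {k : ℂ}

theorem jostM_isPrimitiveOn (hV : ExpDecay V η) (hk : -η ≤ k.im) {b : ℝ} (hb : 0 ≤ b) :
    IsPrimitiveOn (jostM V k) (fun x => -jostP V k x) 0 b :=
  (((IsPrimitiveOn.const hb 1).add ((hV.mul_jostM hk).volterra_isPrimitiveOn hk hb)).congr_deriv
    fun x _ => by simp [jostP]).congr fun x hx => (hV.jostM_eq hk hx.1).symm

theorem jostP_isPrimitiveOn (hV : ExpDecay V η) (hk : -η ≤ k.im) {b : ℝ} (hb : 0 ≤ b) :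
    IsPrimitiveOn (jostP V k) (fun x => -(V x * jostM V k x + 2 * Complex.I * k * jostP V k x))
      0 b :=
  (((hV.mul_jostM hk).tail_isPrimitiveOn hb).add
    (((hV.mul_jostM hk).volterra_isPrimitiveOn hk hb).const_mul (2 * Complex.I * k))).congr_deriv
    fun x _ => by simp only [jostP]; ring

theorem jost_isPrimitiveOn (hV : ExpDecay V η) (hk : -η ≤ k.im) {b : ℝ} (hb : 0 ≤ b) :
    IsPrimitiveOn (jost V k) (jostDeriv V k) 0 b :=
  ((isPrimitiveOn_exp_I_mul k hb).mul (hV.jostM_isPrimitiveOn hk hb)).congr_deriv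
    fun x _ => by simp only [jostDeriv]; ring

theorem jostDeriv_isPrimitiveOn (hV : ExpDecay V η) (hk : -η ≤ k.im) {b : ℝ} (hb : 0 ≤ b) :
    IsPrimitiveOn (jostDeriv V k) (fun x => (V x - k ^ 2) * jost V k x) 0 b :=
  ((isPrimitiveOn_exp_I_mul k hb).mul (((hV.jostM_isPrimitiveOn hk hb).const_mul
    (Complex.I * k)).sub (hV.jostP_isPrimitiveOn hk hb))).congr_deriv fun x _ => by
      simp only [jost]
      linear_combination (k ^ 2 * Complex.exp (Complex.I * k * x) * jostM V k x) * Complex.I_sq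

theorem norm_jost_le (hV : ExpDecay V η) (hk : -η ≤ k.im) {x : ℝ} (hx : 0 ≤ x) :
    ‖jost V k x‖ ≤ jostBound V η * Real.exp (-(k.im * x)) := by
  rw [jost, norm_mul, norm_exp_I_mul, mul_comm]
  exact mul_le_mul_of_nonneg_right (hV.norm_jostM_le hk hx) (Real.exp_nonneg _)

theorem norm_tail_le (hV : ExpDecay V η) {x : ℝ} (hx : 0 ≤ x) :
    ‖∫ t in Ioi x, V t‖ ≤ ∫ t in Ioi 0, Real.exp (2 * η * t) * (1 + t) * ‖V t‖ := by
  refine (norm_integral_le_of_norm_le (hV.int.mono_set (Ioi_subset_Ioi hx))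
    (ae_restrict_of_forall_mem measurableSet_Ioi fun t ht => hV.norm_le (hx.trans_lt ht))).trans ?_
  exact setIntegral_mono_set hV.int (ae_restrict_of_forall_mem measurableSet_Ioi
    fun _ ht => weight_nonneg η V ht) (Ioi_subset_Ioi hx).eventuallyLE

theorem exists_norm_jostDeriv_le (hV : ExpDecay V η) (hk : -η ≤ k.im) :
    ∃ C, ∀ x, 0 ≤ x → ‖jostDeriv V k x‖ ≤ C * Real.exp (-(k.im * x)) := by
  set A := ∫ t in Ioi 0, Real.exp (2 * η * t) * (1 + t) * ‖V t * jostM V k t‖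
  refine ⟨‖k‖ * jostBound V η + (A + 2 * ‖k‖ * (jostBound V η + 1)), fun x hx => ?_⟩
  rw [jostDeriv, norm_mul, norm_exp_I_mul, mul_comm]
  refine mul_le_mul_of_nonneg_right ?_ (Real.exp_nonneg _)
  have h1 := hV.norm_jostM_le hk hx
  have h2 : ‖volterra k (fun t => V t * jostM V k t) x‖ ≤ jostBound V η + 1 := by
    have : volterra k (fun t => V t * jostM V k t) x = jostM V k x - 1 := by
      rw [hV.jostM_eq hk hx]
      ring
    rw [this]
    exact (norm_sub_le _ _).trans (by simpa using h1)
  refine (norm_sub_le _ _).trans (add_le_add ?_ ((norm_add_le _ _).trans (add_le_add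
    ((hV.mul_jostM hk).norm_tail_le hx) ?_)))
  · rw [norm_mul, norm_mul, Complex.norm_I, one_mul]
    gcongr
  · rw [norm_mul, norm_mul, norm_mul, Complex.norm_I, mul_one, Complex.norm_ofNat]
    gcongr

theorem tendsto_jostM (hV : ExpDecay V η) (hk : -η ≤ k.im) :
    Tendsto (jostM V k) atTop (𝓝 1) := by
  -- Tails of a convergent integral vanish, and they control `jostM V k x - 1`.
  have h1 : Tendsto (fun x => ∫ t in Ioi x, Real.exp (2 * η * t) * (1 + t) * ‖V t‖) atTop (𝓝 0) := by
    have h2 := (intervalIntegral_tendsto_integral_Ioi 0 hV.int tendsto_id).const_sub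
      (∫ t in Ioi 0, Real.exp (2 * η * t) * (1 + t) * ‖V t‖)
    rw [sub_self] at h2
    refine h2.congr' ?_
    filter_upwards [eventually_ge_atTop 0] with x hx
    have := (IsPrimitiveOn.integral_Ioi hx hV.int).sub_eq (left_mem_Icc.2 hx) (right_mem_Icc.2 hx)
    rw [intervalIntegral.integral_neg] at this
    simp only [id]
    linarith
  rw [tendsto_iff_norm_sub_tendsto_zero]
  have h2 := ((Real.continuous_exp.tendsto 0).comp h1).sub_const 1
  rw [Real.exp_zero, sub_self] at h2
  refine squeeze_zero' (Eventually.of_forall fun _ => norm_nonneg _) ?_ h2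
  filter_upwards [eventually_ge_atTop 0] with x hx
  exact (hV.isJostWeight hk).norm_jostM_sub_one_le hV hk hx

end ExpDecay

/-! ### Wronskians of square integrable solutions -/

theorem intervalIntegrable_norm_sq {f : ℝ → ℂ} (hf : IntegrableOn (fun x => ‖f x‖ ^ 2) (Ioi 0))
    {a b : ℝ} (ha : 0 ≤ a) (hab : a ≤ b) :
    IntervalIntegrable (fun x => ‖f x‖ ^ 2) volume a b := by
  rw [intervalIntegrable_iff_integrableOn_Ioc_of_le hab]
  exact hf.mono_set fun t ht => ha.trans_lt ht.1

/-- A nonnegative function bounded below by a positive constant near infinity is not integrable. -/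
theorem not_integrableOn_of_le {F : ℝ → ℝ} {x₁ c : ℝ} (hc : 0 < c) (hx₁ : 0 ≤ x₁)
    (hF : ∀ x, x₁ < x → c ≤ F x) : ¬ IntegrableOn F (Ioi 0) := by
  intro h
  have h1 : IntegrableOn (fun _ : ℝ => c) (Ioi x₁) := by
    refine Integrable.mono' (h.mono_set (Ioi_subset_Ioi hx₁)) aestronglyMeasurable_const ?_
    refine ae_restrict_of_forall_mem measurableSet_Ioi fun x hx => ?_
    rw [Real.norm_of_nonneg hc.le]
    exact hF x hx
  rw [integrableOn_const_iff] at h1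
  simp [hc.ne'] at h1

/-- If `f` is square integrable and `ψ, ψ' = χ` are bounded, a limit at infinity of the Wronskian
`f ψ' - f' ψ` can only be zero. -/
theorem wronskian_limit_eq_zero {f g ψ χ : ℝ → ℂ} {c : ℂ} {C : ℝ}
    (hf : ∀ b, 0 ≤ b → IsPrimitiveOn f g 0 b) (hψ : ∀ b, 0 ≤ b → IsPrimitiveOn ψ χ 0 b)
    (hf2 : IntegrableOn (fun x => ‖f x‖ ^ 2) (Ioi 0)) (hψC : ∀ x, 0 ≤ x → ‖ψ x‖ ≤ C)
    (hχC : ∀ x, 0 ≤ x → ‖χ x‖ ≤ C)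
    (hW : Tendsto (fun x => f x * χ x - g x * ψ x) atTop (𝓝 c)) : c = 0 := by
  by_contra hc
  set δ : ℝ := ‖c‖ with hδ
  have hδ0 : 0 < δ := norm_pos_iff.2 hc
  have hC0 : 0 ≤ C := (norm_nonneg _).trans (hψC 0 le_rfl)
  obtain ⟨y₀, hy₀⟩ := (Metric.tendsto_atTop.1 hW) (δ / 4) (by positivity)
  set x₀ := max y₀ 0 with hx₀
  have hx₀0 : 0 ≤ x₀ := le_max_right _ _
  set I : ℝ := ∫ x in Ioi 0, ‖f x‖ ^ 2 with hI
  -- Nothing is known about the size of `g`, so the Wronskian is integrated by parts: its integral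
  -- over `[x₀, x]` is `2 ∫ f χ` minus the boundary terms of `f ψ`. The left side grows like `‖c‖ (x
  -- - x₀)` while `∫ f χ` cannot keep pace, so `‖f x‖` would have to grow linearly.
  have key : ∀ x, x₀ ≤ x →
      δ / 2 * (x - x₀) - (4 * C ^ 2 / δ * I + C * ‖f x₀‖) ≤ C * ‖f x‖ := by
    intro x hx
    have hx0 : 0 ≤ x := hx₀0.trans hx
    have hf' := (hf x hx0).mono hx₀0 hx le_rfl
    have hψ' := (hψ x hx0).mono hx₀0 hx le_rfl
    have hcf : ContinuousOn f (uIcc x₀ x) := by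
      rw [uIcc_of_le hx]
      exact hf'.continuousOn
    have hcψ : ContinuousOn ψ (uIcc x₀ x) := by
      rw [uIcc_of_le hx]
      exact hψ'.continuousOn
    have i1 : IntervalIntegrable (fun t => f t * χ t) volume x₀ x := hψ'.int.continuousOn_mul hcf
    have i2 : IntervalIntegrable (fun t => g t * ψ t) volume x₀ x := hf'.int.mul_continuousOn hcψ
    have e1 := (hf'.mul hψ').sub_eq (left_mem_Icc.2 hx) (right_mem_Icc.2 hx)
    have e2 : ∫ t in x₀..x, (f t * χ t - g t * ψ t)
        = 2 * (∫ t in x₀..x, f t * χ t) - (f x * ψ x - f x₀ * ψ x₀) := by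
      rw [e1, intervalIntegral.integral_sub i1 i2, intervalIntegral.integral_add i2 i1]
      ring
    have b1 : ‖(∫ t in x₀..x, (f t * χ t - g t * ψ t)) - (x - x₀ : ℝ) * c‖ ≤ δ / 4 * (x - x₀) := by
      have h1 : (∫ t in x₀..x, (f t * χ t - g t * ψ t)) - (x - x₀ : ℝ) * c
          = ∫ t in x₀..x, (f t * χ t - g t * ψ t - c) := by
        rw [intervalIntegral.integral_sub (i1.sub i2) intervalIntegrable_const,
          intervalIntegral.integral_const]
        simp
      rw [h1]
      refine (intervalIntegral.norm_integral_le_of_norm_le_const (C := δ / 4) fun t ht => ?_).trans_eq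
        (by rw [abs_of_nonneg (by linarith)])
      rw [uIoc_of_le hx] at ht
      have := hy₀ t ((le_max_left _ _).trans ht.1.le)
      rw [dist_eq_norm] at this
      exact this.le
    -- Weighted arithmetic-geometric mean: the weights make the linear part only a quarter of the
    -- growth rate `δ`, and the rest is bounded by the `L²` norm of `f`.
    have b2 : ‖2 * (∫ t in x₀..x, f t * χ t)‖ ≤ δ / 4 * (x - x₀) + 4 * C ^ 2 / δ * I := by
      have i3 : IntervalIntegrable (fun t => ‖f t‖ ^ 2) volume x₀ x :=
        intervalIntegrable_norm_sq hf2 hx₀0 hx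
      have h1 : ∫ t in x₀..x, 2 * ‖f t * χ t‖
          ≤ ∫ t in x₀..x, (δ / 4 + 4 * C ^ 2 / δ * ‖f t‖ ^ 2) := by
        refine intervalIntegral.integral_mono_on hx (i1.norm.const_mul 2)
          (intervalIntegrable_const.add (i3.const_mul _)) fun t ht => ?_
        rw [norm_mul]
        have h2 : ‖f t‖ * ‖χ t‖ ≤ ‖f t‖ * C :=
          mul_le_mul_of_nonneg_left (hχC t (hx₀0.trans ht.1)) (norm_nonneg _)
        have h3 : δ / 4 + 4 * C ^ 2 / δ * ‖f t‖ ^ 2 - 2 * (‖f t‖ * C)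
            = (δ / 2 - 2 * C * ‖f t‖) ^ 2 / δ := by
          field_simp
          ring
        have h4 : 0 ≤ (δ / 2 - 2 * C * ‖f t‖) ^ 2 / δ := by positivity
        linarith
      have h2 : ∫ t in x₀..x, ‖f t‖ ^ 2 ≤ I := by
        rw [intervalIntegral.integral_of_le hx]
        exact setIntegral_mono_set hf2 (Eventually.of_forall fun t => sq_nonneg _)
          (LE.le.eventuallyLE fun t ht => hx₀0.trans_lt ht.1)
      rw [intervalIntegral.integral_add intervalIntegrable_const (i3.const_mul _),
        intervalIntegral.integral_const_mul, intervalIntegral.integral_const,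
        intervalIntegral.integral_const_mul] at h1
      have h3 := intervalIntegral.norm_integral_le_integral_norm (μ := volume)
        (f := fun t => f t * χ t) hx
      have h4 : 4 * C ^ 2 / δ * (∫ t in x₀..x, ‖f t‖ ^ 2) ≤ 4 * C ^ 2 / δ * I :=
        mul_le_mul_of_nonneg_left h2 (by positivity)
      rw [norm_mul, Complex.norm_ofNat]
      simp only [smul_eq_mul] at h1
      linarith
    have b3 : ‖f x * ψ x‖ ≤ C * ‖f x‖ := by
      rw [norm_mul, mul_comm]
      exact mul_le_mul_of_nonneg_right (hψC x hx0) (norm_nonneg _)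
    have b4 : ‖f x₀ * ψ x₀‖ ≤ C * ‖f x₀‖ := by
      rw [norm_mul, mul_comm]
      exact mul_le_mul_of_nonneg_right (hψC x₀ hx₀0) (norm_nonneg _)
    have b5 : ‖((x - x₀ : ℝ) : ℂ) * c‖ = (x - x₀) * δ := by
      rw [norm_mul, Complex.norm_real, Real.norm_of_nonneg (by linarith)]
    have t1 : ((x - x₀ : ℝ) : ℂ) * c = 2 * (∫ t in x₀..x, f t * χ t) - (f x * ψ x - f x₀ * ψ x₀)
        - ((∫ t in x₀..x, (f t * χ t - g t * ψ t)) - (x - x₀ : ℝ) * c) := by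
      rw [e2]
      ring
    have t2 := norm_sub_le (2 * (∫ t in x₀..x, f t * χ t) - (f x * ψ x - f x₀ * ψ x₀))
      ((∫ t in x₀..x, (f t * χ t - g t * ψ t)) - (x - x₀ : ℝ) * c)
    have t3 := norm_sub_le (2 * (∫ t in x₀..x, f t * χ t)) (f x * ψ x - f x₀ * ψ x₀)
    have t4 := norm_sub_le (f x * ψ x) (f x₀ * ψ x₀)
    rw [← t1, b5] at t2
    linarith
  set K := 4 * C ^ 2 / δ * I + C * ‖f x₀‖ with hK
  set x₁ := x₀ + (2 / δ) * (|K| + 1) with hx₁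
  have hx₁x₀ : x₀ ≤ x₁ := by
    have : 0 ≤ (2 / δ) * (|K| + 1) := by positivity
    linarith
  have hlow : ∀ x, x₁ < x → 1 ≤ C * ‖f x‖ := fun x hx => by
    have h1 := key x (hx₁x₀.trans hx.le)
    have h2 : δ / 2 * (x₁ - x₀) = |K| + 1 := by
      rw [hx₁]
      field_simp
      ring
    have h3 : δ / 2 * (x₁ - x₀) ≤ δ / 2 * (x - x₀) := by gcongr
    linarith [le_abs_self K]
  refine not_integrableOn_of_le (c := 1) one_pos (hx₀0.trans hx₁x₀) (fun x hx => ?_)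
    (hf2.const_mul (C ^ 2))
  have := hlow x hx
  nlinarith

/-! ### Elements of the operator domain and their Wronskian with the Jost solution. -/

namespace IsDirichletPair

variable {V : ℝ → ℂ} {u v : L2HalfLine} {f g : ℝ → ℂ}

theorem isPrimitiveOn_deriv (h : IsDirichletPair V u v f g) {b : ℝ} (hb : 0 ≤ b) :
    IsPrimitiveOn g (fun t => V t * f t - v t) 0 b :=
  ⟨hb, h.locInt b hb, fun x hx => h.eq_integral x hx.1⟩

theorem isPrimitiveOn (h : IsDirichletPair V u v f g) {b : ℝ} (hb : 0 ≤ b) :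
    IsPrimitiveOn f g 0 b :=
  IsPrimitiveOn.of_hasDerivWithinAt hb (fun x hx => (h.deriv x hx.1).mono Icc_subset_Ici_self)
    (h.isPrimitiveOn_deriv hb).continuousOn

theorem memLp (h : IsDirichletPair V u v f g) : MemLp f 2 (volume.restrict (Ioi 0)) :=
  (memLp_congr_ae h.ae_eq).1 (Lp.memLp u)

theorem integrableOn_norm_sq (h : IsDirichletPair V u v f g) :
    IntegrableOn (fun x => ‖f x‖ ^ 2) (Ioi 0) :=
  (memLp_two_iff_integrable_sq_norm h.memLp.1).1 h.memLp

theorem eq_zero (h : IsDirichletPair V u v f g) (hf : ∀ x, 0 ≤ x → f x = 0) : u = 0 := by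
  rw [Lp.eq_zero_iff_ae_eq_zero]
  refine h.ae_eq.trans ?_
  exact ae_restrict_of_forall_mem measurableSet_Ioi fun x hx => hf x (le_of_lt hx)

theorem wronskian_isPrimitiveOn (h : IsDirichletPair V u v f g) {η : ℝ} {k : ℂ}
    (hV : ExpDecay V η) (hk : -η ≤ k.im) {b : ℝ} (hb : 0 ≤ b) :
    IsPrimitiveOn (fun x => f x * jostDeriv V k x - g x * jost V k x)
      (fun x => (v x - k ^ 2 * f x) * jost V k x) 0 b :=
  (((h.isPrimitiveOn hb).mul (hV.jostDeriv_isPrimitiveOn hk hb)).sub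
    ((h.isPrimitiveOn_deriv hb).mul (hV.jost_isPrimitiveOn hk hb))).congr_deriv
    fun x _ => by ring

end IsDirichletPair

theorem jost_zero (V : ℝ → ℂ) (k : ℂ) : jost V k 0 = jostM V k 0 := by simp [jost]

namespace ExpDecay

variable {V : ℝ → ℂ} {η : ℝ} {k : ℂ}

theorem norm_jost_le_bound (hV : ExpDecay V η) (hk : 0 ≤ k.im) {x : ℝ} (hx : 0 ≤ x) :
    ‖jost V k x‖ ≤ jostBound V η := by
  refine (hV.norm_jost_le (by linarith [hV.nonneg]) hx).trans ?_
  refine mul_le_of_le_one_right (Real.exp_nonneg _) (Real.exp_le_one_iff.2 ?_)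
  have := mul_nonneg hk hx
  linarith

theorem exists_norm_jostDeriv_le_bound (hV : ExpDecay V η) (hk : 0 ≤ k.im) :
    ∃ C, ∀ x, 0 ≤ x → ‖jostDeriv V k x‖ ≤ C := by
  obtain ⟨C, hC⟩ := hV.exists_norm_jostDeriv_le (k := k) (by linarith [hV.nonneg])
  have hC0 : 0 ≤ C := by simpa using (norm_nonneg _).trans (hC 0 le_rfl)
  refine ⟨C, fun x hx => (hC x hx).trans (mul_le_of_le_one_right hC0 (Real.exp_le_one_iff.2 ?_))⟩
  have := mul_nonneg hk hx
  linarith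

theorem wronskian_eq_zero (hV : ExpDecay V η) (hk : 0 ≤ k.im) {u v : L2HalfLine} {f g : ℝ → ℂ}
    (h : IsDirichletPair V u v f g) {c : ℂ}
    (hc : Tendsto (fun x => f x * jostDeriv V k x - g x * jost V k x) atTop (𝓝 c)) : c = 0 := by
  have hk' : -η ≤ k.im := by linarith [hV.nonneg]
  obtain ⟨C, hC⟩ := hV.exists_norm_jostDeriv_le_bound hk
  exact wronskian_limit_eq_zero (C := max (jostBound V η) C) (fun b hb => h.isPrimitiveOn hb)
    (fun b hb => hV.jost_isPrimitiveOn hk' hb) h.integrableOn_norm_sq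
    (fun x hx => (hV.norm_jost_le_bound hk hx).trans (le_max_left _ _))
    (fun x hx => (hC x hx).trans (le_max_right _ _)) hc

theorem exp_memLp {b C : ℝ} (hb : 0 < b) :
    MemLp (fun x : ℝ => C * Real.exp (-(b * x))) 2 (volume.restrict (Ioi 0)) := by
  rw [memLp_two_iff_integrable_sq_norm (Continuous.aestronglyMeasurable (by fun_prop))]
  refine ((exp_neg_integrableOn_Ioi 0 (b := 2 * b) (by linarith)).const_mul (C ^ 2)).congr
    (Eventually.of_forall fun x => ?_)
  simp only [Real.norm_eq_abs, sq_abs, mul_pow, ← Real.exp_nat_mul]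
  congr 2
  push_cast
  ring

theorem jost_memLp (hV : ExpDecay V η) (hk : 0 < k.im) :
    MemLp (jost V k) 2 (volume.restrict (Ioi 0)) := by
  have hk' : -η ≤ k.im := by linarith [hV.nonneg]
  refine (exp_memLp (C := jostBound V η) hk).mono ?_ ?_
  · exact ((continuousOn_Ici_of_isPrimitiveOn fun b hb => hV.jost_isPrimitiveOn hk' hb).mono
      Ioi_subset_Ici_self).aestronglyMeasurable measurableSet_Ioi
  · refine ae_restrict_of_forall_mem measurableSet_Ioi fun x hx => ?_
    exact (hV.norm_jost_le hk' (le_of_lt hx)).trans (le_abs_self _)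

/-- Pairing `(T - k²) u` with the Jost solution. -/
theorem deriv_mul_jost_zero (hV : ExpDecay V η) (hk : 0 < k.im) {u v : L2HalfLine} {f g : ℝ → ℂ}
    (h : IsDirichletPair V u v f g) :
    g 0 * jostM V k 0 = ∫ x in Ioi 0, (v x - k ^ 2 * f x) * jost V k x := by
  have hk' : -η ≤ k.im := by linarith [hV.nonneg]
  have hint : IntegrableOn (fun x => (v x - k ^ 2 * f x) * jost V k x) (Ioi 0) :=
    ((Lp.memLp v).sub (h.memLp.const_mul (k ^ 2))).integrable_mul (hV.jost_memLp hk)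
  -- The Wronskian has integrable derivative, so it converges. Its limit must be zero by
  -- `wronskian_eq_zero`, which is the asserted identity.
  have hlim : Tendsto (fun x => f x * jostDeriv V k x - g x * jost V k x) atTop
      (𝓝 (-(g 0 * jostM V k 0) + ∫ x in Ioi 0, (v x - k ^ 2 * f x) * jost V k x)) := by
    refine (((intervalIntegral_tendsto_integral_Ioi 0 hint tendsto_id).const_add
      (-(g 0 * jostM V k 0)))).congr' ?_
    filter_upwards [eventually_ge_atTop 0] with x hx
    rw [(h.wronskian_isPrimitiveOn hV hk' hx).eq x (right_mem_Icc.2 hx), h.dirichlet, jost_zero]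
    simp
  have := hV.wronskian_eq_zero hk.le h hlim
  linear_combination -this

theorem intervalIntegrable_sub_const (hV : ExpDecay V η) (c : ℂ) {b : ℝ} (hb : 0 ≤ b) :
    IntervalIntegrable (fun x => V x - c) volume 0 b := by
  refine IntervalIntegrable.sub ?_ intervalIntegrable_const
  rw [intervalIntegrable_iff_integrableOn_Ioc_of_le hb]
  exact hV.integrableOn.mono_set Ioc_subset_Ioi_self

theorem deriv_isPrimitiveOn_of_eigen {u : L2HalfLine} {z : ℂ} {f g : ℝ → ℂ}
    (h : IsDirichletPair V u (z • u) f g) {b : ℝ} (hb : 0 ≤ b) :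
    IsPrimitiveOn g (fun x => (V x - z) * f x) 0 b := by
  refine (h.isPrimitiveOn_deriv hb).congr_deriv_ae ?_
  have h1 : ((z • u : L2HalfLine) : ℝ → ℂ) =ᵐ[volume.restrict (Ioi 0)] fun x => z * f x := by
    filter_upwards [Lp.coeFn_smul z u, h.ae_eq] with x h1 h2
    rw [h1, Pi.smul_apply, h2, smul_eq_mul]
  filter_upwards [ae_mono (Measure.restrict_mono Ioc_subset_Ioi_self le_rfl) h1] with x hx
  rw [hx]
  ring

theorem eigen_deriv_ne_zero (hV : ExpDecay V η) {u : L2HalfLine} {z : ℂ} {f g : ℝ → ℂ}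
    (h : IsDirichletPair V u (z • u) f g) (hu : u ≠ 0) : g 0 ≠ 0 := by
  intro hg
  refine hu (h.eq_zero fun x hx => ?_)
  exact (eqZero_of_cauchyData_eq_zero (h.isPrimitiveOn hx) (deriv_isPrimitiveOn_of_eigen h hx)
    (hV.intervalIntegrable_sub_const z hx) (left_mem_Icc.2 hx) h.dirichlet hg x
    (right_mem_Icc.2 hx)).1

/-- Eigenfunctions are multiples of the Jost solution. -/
theorem exists_eq_mul_jost (hV : ExpDecay V η) (hk : 0 ≤ k.im) {u : L2HalfLine} {f g : ℝ → ℂ}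
    (h : IsDirichletPair V u (k ^ 2 • u) f g) : ∃ α : ℂ, ∀ x, 0 ≤ x → f x = α * jost V k x := by
  have hk' : -η ≤ k.im := by linarith [hV.nonneg]
  have hWc : ∀ x, 0 ≤ x → f x * jostDeriv V k x - g x * jost V k x = -(g 0 * jostM V k 0) := by
    intro x hx
    have h1 := ((h.isPrimitiveOn hx).mul (hV.jostDeriv_isPrimitiveOn hk' hx)).sub
      ((deriv_isPrimitiveOn_of_eigen h hx).mul (hV.jost_isPrimitiveOn hk' hx))
    have h2 := (h1.congr_deriv (f'' := fun _ => 0) fun x _ => by ring).eq x (right_mem_Icc.2 hx)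
    simpa [h.dirichlet, jost_zero] using h2
  have hW0 : -(g 0 * jostM V k 0) = 0 := hV.wronskian_eq_zero hk h
    (tendsto_const_nhds.congr' (by
      filter_upwards [eventually_ge_atTop 0] with x hx using (hWc x hx).symm))
  -- The Wronskian vanishes identically. At a point where the Jost solution is nonzero, matching
  -- values therefore also matches derivatives, and uniqueness for the Cauchy problem finishes. Such
  -- a point exists because `jostM` tends to `1`.
  obtain ⟨x₁, hx₁0, hx₁⟩ : ∃ x₁ : ℝ, 0 ≤ x₁ ∧ jostM V k x₁ ≠ 0 :=
    ((eventually_ge_atTop 0).and ((hV.tendsto_jostM hk').eventually_ne one_ne_zero)).exists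
  have hψ₁ : jost V k x₁ ≠ 0 := mul_ne_zero (Complex.exp_ne_zero _) hx₁
  refine ⟨f x₁ / jost V k x₁, fun x hx => ?_⟩
  set α := f x₁ / jost V k x₁ with hα
  have hb : 0 ≤ max x x₁ := hx.trans (le_max_left _ _)
  have e1 : f x₁ - α * jost V k x₁ = 0 := by
    rw [hα]
    field_simp
    simp
  have e2 : g x₁ - α * jostDeriv V k x₁ = 0 := by
    have := hWc x₁ hx₁0
    rw [hW0] at this
    rw [hα]
    field_simp
    linear_combination -this
  have := (eqZero_of_cauchyData_eq_zero (K := fun x => V x - k ^ 2)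
    ((h.isPrimitiveOn hb).sub ((hV.jost_isPrimitiveOn hk' hb).const_mul α))
    (((deriv_isPrimitiveOn_of_eigen h hb).sub
      ((hV.jostDeriv_isPrimitiveOn hk' hb).const_mul α)).congr_deriv fun x _ => by ring)
    (hV.intervalIntegrable_sub_const _ hb) ⟨hx₁0, le_max_right _ _⟩ e1 e2 x
    ⟨hx, le_max_left _ _⟩).1
  linear_combination this

/-- Eigenvalues are squares of zeros of the Jost function in the open upper half-plane. -/
theorem im_pos_and_jostM_eq_zero (hV : ExpDecay V η) (hk : 0 ≤ k.im) {u : L2HalfLine}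
    {f g : ℝ → ℂ} (h : IsDirichletPair V u (k ^ 2 • u) f g) (hu : u ≠ 0) :
    0 < k.im ∧ jostM V k 0 = 0 := by
  have hk' : -η ≤ k.im := by linarith [hV.nonneg]
  obtain ⟨α, hα⟩ := hV.exists_eq_mul_jost hk h
  have hα0 : α ≠ 0 := by
    rintro rfl
    exact hu (h.eq_zero fun x hx => by rw [hα x hx, zero_mul])
  constructor
  -- For real `k` the modulus of the Jost solution tends to `1`, so no nonzero multiple of it is
  -- square integrable. This excludes eigenvalues in `[0, ∞)`.
  · refine lt_of_le_of_ne hk fun hk0 => ?_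
    obtain ⟨y, hy⟩ := (Metric.tendsto_atTop.1 (hV.tendsto_jostM hk')) (1 / 2) (by norm_num)
    refine not_integrableOn_of_le (c := (‖α‖ * (1 / 2)) ^ 2) (by positivity) (le_max_right y 0)
      (fun x hx => ?_) h.integrableOn_norm_sq
    have hx0 : 0 ≤ x := (le_max_right y 0).trans hx.le
    have h1 := hy x ((le_max_left y 0).trans hx.le)
    rw [dist_eq_norm] at h1
    rw [hα x hx0, norm_mul, jost, norm_mul, norm_exp_I_mul, ← hk0]
    simp only [zero_mul, neg_zero, Real.exp_zero, one_mul]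
    have h2 : (1 : ℝ) / 2 ≤ ‖jostM V k x‖ := by
      have := norm_sub_norm_le (1 : ℂ) (jostM V k x)
      rw [norm_one, norm_sub_rev] at this
      linarith
    gcongr
  · have := hα 0 le_rfl
    rw [h.dirichlet, jost_zero] at this
    exact (mul_eq_zero.1 this.symm).resolve_left hα0

end ExpDecay

/-! ### Algebraic multiplicities -/

section RootSubspace

variable {E : Type*} [AddCommGroup E] [Module ℂ E] {T : E →ₗ.[ℂ] E} {z : ℂ}

theorem mem_powKer_succ {n : ℕ} {u : E} :
    u ∈ powKer T z (n + 1) ↔ ∃ y : T.domain, T y - z • (y : E) ∈ powKer T z n ∧ (y : E) = u := by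
  rw [powKer, Submodule.mem_map]
  rfl

/-- The chain satisfies `(T - z) c (j + 1) = c j`, expressed through the graph so that domain
conditions need no separate bookkeeping. -/
theorem exists_jordanChain {n : ℕ} {u : E} (hu : u ∈ powKer T z n) :
    ∃ c : ℕ → E, c 0 = 0 ∧ c n = u ∧ ∀ j < n, (c (j + 1), z • c (j + 1) + c j) ∈ T.graph := by
  induction n generalizing u with
  | zero => exact ⟨0, rfl, ((Submodule.mem_bot ℂ).1 hu).symm, by simp⟩
  | succ n ih =>
    obtain ⟨y, hy, rfl⟩ := mem_powKer_succ.1 hu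
    obtain ⟨c, hc0, hcn, hc⟩ := ih hy
    refine ⟨Function.update c (n + 1) y, ?_, by simp, fun j hj => ?_⟩
    · rw [Function.update_of_ne (by omega), hc0]
    · rcases Nat.lt_succ_iff_lt_or_eq.1 hj with h | rfl
      · rw [Function.update_of_ne (by omega), Function.update_of_ne (by omega)]
        exact hc j h
      · rw [Function.update_self, Function.update_of_ne (by omega), hcn, add_sub_cancel]
        exact T.mem_graph y

theorem mem_powKer_of_jordanChain {c : ℕ → E} {j₀ : ℕ} (h0 : c j₀ = 0) (i : ℕ)
    (hc : ∀ j, j₀ ≤ j → j < j₀ + i → (c (j + 1), z • c (j + 1) + c j) ∈ T.graph) :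
    c (j₀ + i) ∈ powKer T z i := by
  induction i with
  | zero => simp [h0]
  | succ i ih =>
    have h1 := ih fun j hj hj' => hc j hj (by omega)
    obtain ⟨y, hy1, hy2⟩ := (LinearPMap.mem_graph_iff T).1 (hc (j₀ + i) (by omega) (by omega))
    refine mem_powKer_succ.2 ⟨y, ?_, hy1⟩
    simp only at hy1 hy2
    rw [hy2, hy1, add_sub_cancel_left]
    exact h1

theorem powKer_le_of_succ_le {d : ℕ} (h : powKer T z (d + 1) ≤ powKer T z d) (n : ℕ) :
    powKer T z n ≤ powKer T z d := by
  induction n with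
  | zero => exact bot_le
  | succ n ih => exact (Submodule.map_mono (Submodule.comap_mono ih)).trans h

/-- Passing from one power to the next takes a preimage under `T - z`, which adds at most the
dimension of `ker (T - z)`, here at most one. -/
theorem rank_powKer_le (h1 : ∀ u v : E, u ≠ 0 → (u, z • u) ∈ T.graph → (v, z • v) ∈ T.graph →
    ∃ α : ℂ, v = α • u) (n : ℕ) : Module.rank ℂ (powKer T z n) ≤ n := by
  have hker : Module.rank ℂ (LinearMap.ker (T.toFun - z • T.domain.subtype)) ≤ 1 := by
    have hmem : ∀ y : LinearMap.ker (T.toFun - z • T.domain.subtype),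
        (((y : T.domain) : E), z • ((y : T.domain) : E)) ∈ T.graph := fun y => by
      have h2 : T y.1 - z • ((y : T.domain) : E) = 0 := y.2
      rw [← sub_eq_zero.1 h2]
      exact T.mem_graph y.1
    rw [rank_le_one_iff]
    by_cases h0 : ∀ y : LinearMap.ker (T.toFun - z • T.domain.subtype), y = 0
    · exact ⟨0, fun y => ⟨0, by simp [h0 y]⟩⟩
    · push Not at h0
      obtain ⟨y, hy⟩ := h0
      refine ⟨y, fun w => ?_⟩
      obtain ⟨α, hα⟩ := h1 y w (fun h => hy (by ext; simpa using h)) (hmem y) (hmem w)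
      exact ⟨α, by ext; simp [hα]⟩
  induction n with
  | zero => exact (rank_bot ℂ E).le.trans (by simp)
  | succ n ih =>
    have h2 := LinearMap.lift_rank_comap_le (f := T.toFun - z • T.domain.subtype) (powKer T z n)
    rw [Cardinal.lift_id, Cardinal.lift_id, Cardinal.lift_id] at h2
    refine (rank_map_le _ _).trans (h2.trans ?_)
    push_cast
    exact add_le_add ih hker

/-- If every Jordan chain of length `d + 1` has `c 1 = 0`, it is really a chain of length `d`. The
kernels of the powers then stabilise at the `d`-th one, of dimension at most `d`. -/
theorem algMultiplicity_le {d : ℕ} (h1 : ∀ u v : E, u ≠ 0 → (u, z • u) ∈ T.graph →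
    (v, z • v) ∈ T.graph → ∃ α : ℂ, v = α • u)
    (h2 : ∀ c : ℕ → E, c 0 = 0 → c 1 ≠ 0 →
      ¬ ∀ j < d + 1, (c (j + 1), z • c (j + 1) + c j) ∈ T.graph) :
    algMultiplicity T z ≤ d := by
  have h3 : powKer T z (d + 1) ≤ powKer T z d := by
    intro u hu
    obtain ⟨c, hc0, hcn, hc⟩ := exists_jordanChain hu
    have hc1 : c 1 = 0 := by
      by_contra h
      exact h2 c hc0 h hc
    have := mem_powKer_of_jordanChain hc1 d fun j _ hj => hc j (by omega)
    rwa [add_comm, hcn] at this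
  have h4 : Module.rank ℂ (⨆ n : ℕ, powKer T z n : Submodule ℂ E) ≤ (d : Cardinal) :=
    (Submodule.rank_mono (iSup_le (powKer_le_of_succ_le h3))).trans (rank_powKer_le h1 d)
  simpa [algMultiplicity] using Cardinal.toENat.monotone' h4

end RootSubspace

/-- An analytic function that is `O((z - z₀) ^ m)` vanishes to order at least `m`. -/
theorem le_analyticOrderAt_of_isBigO {F : ℂ → ℂ} {z₀ : ℂ} (hF : AnalyticAt ℂ F z₀) {m : ℕ}
    (h : F =O[𝓝 z₀] fun z => (z - z₀) ^ m) : (m : ℕ∞) ≤ analyticOrderAt F z₀ := by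
  by_contra! hlt
  obtain ⟨d, hd⟩ := ENat.ne_top_iff_exists.1 hlt.ne_top
  rw [← hd, Nat.cast_lt] at hlt
  obtain ⟨g, hg, hg0, hFg⟩ := hF.analyticOrderAt_eq_natCast.1 hd.symm
  obtain ⟨C, hC⟩ := h.bound
  refine hg0 (norm_le_zero_iff.1 ?_)
  have h1 : Tendsto (fun z => ‖g z‖) (𝓝[≠] z₀) (𝓝 ‖g z₀‖) :=
    (hg.continuousAt.norm.tendsto).mono_left nhdsWithin_le_nhds
  -- If the order `d` were below `m`, dividing by `(z - z₀) ^ d` would leave a bound tending to zero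
  -- for the nonvanishing factor `g`.
  have h2 : Tendsto (fun z => C * ‖(z - z₀) ^ (m - d)‖) (𝓝[≠] z₀) (𝓝 0) := by
    have : ContinuousAt (fun z => C * ‖(z - z₀) ^ (m - d)‖) z₀ := by fun_prop
    have h3 := this.tendsto
    simp only [sub_self, zero_pow (Nat.sub_ne_zero_of_lt hlt), norm_zero, mul_zero] at h3
    exact h3.mono_left nhdsWithin_le_nhds
  refine le_of_tendsto_of_tendsto h1 h2 ?_
  filter_upwards [self_mem_nhdsWithin, nhdsWithin_le_nhds hC, nhdsWithin_le_nhds hFg]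
    with z hz hCz hFz
  have hz0 : 0 < ‖(z - z₀) ^ d‖ := norm_pos_iff.2 (pow_ne_zero _ (sub_ne_zero.2 hz))
  rw [hFz, smul_eq_mul, norm_mul, ← Nat.add_sub_of_le hlt.le, pow_add, norm_mul] at hCz
  refine le_of_mul_le_mul_left ?_ hz0
  linarith

/-! ### Jordan chains and the order of vanishing of the Jost function. -/

namespace ExpDecay

variable {V : ℝ → ℂ} {η : ℝ} {k : ℂ}

theorem jostM_zero_analyticAt (hV : ExpDecay V η) (hk : -η < k.im) :
    AnalyticAt ℂ (fun κ => jostM V κ 0) k :=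
  (hV.jostM_differentiableOn le_rfl).analyticAt ((isOpen_im_gt _).mem_nhds hk)

theorem deriv_mul_jost_zero_of_chain (hV : ExpDecay V η) {κ z : ℂ} (hκ : 0 < κ.im)
    {u w : L2HalfLine} {f g : ℝ → ℂ} (h : IsDirichletPair V u (z • u + w) f g) :
    g 0 * jostM V κ 0 = (∫ x in Ioi 0, w x * jost V κ x)
      - (κ ^ 2 - z) * ∫ x in Ioi 0, u x * jost V κ x := by
  have hi : ∀ u : L2HalfLine, IntegrableOn (fun x => u x * jost V κ x) (Ioi 0) :=
    fun u => (Lp.memLp u).integrable_mul (hV.jost_memLp hκ)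
  rw [hV.deriv_mul_jost_zero hκ h, ← integral_const_mul, ← integral_sub (hi w) ((hi u).const_mul _)]
  refine integral_congr_ae ?_
  filter_upwards [h.ae_eq, Lp.coeFn_add (z • u) w, Lp.coeFn_smul z u] with x h1 h2 h3
  rw [h2, Pi.add_apply, h3, Pi.smul_apply, smul_eq_mul, ← h1]
  ring

/-- Let I_j(κ) be the integral of c_j against the Jost solution at κ. Each link of the chain gives
g_j(0) F(κ) = I_j - (κ² - k²) I_{j+1}. Multiplying by (κ² - k²)^j and summing telescopes to G(κ)
F(κ) = -(κ² - k²)^m I_m, because I_0 = 0. Since G(k) = g_0(0) ≠ 0, F is O((κ - k)^m). No derivatives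
in the spectral parameter are needed. -/
theorem le_analyticOrderAt_of_chain (hV : ExpDecay V η) (hk : 0 < k.im) {c : ℕ → L2HalfLine}
    {m : ℕ} (hm : 0 < m) (h0 : c 0 = 0) (h1 : c 1 ≠ 0)
    (hc : ∀ j < m, (c (j + 1), k ^ 2 • c (j + 1) + c j) ∈ schrodingerGraph V) :
    (m : ℕ∞) ≤ analyticOrderAt (fun κ => jostM V κ 0) k := by
  refine le_analyticOrderAt_of_isBigO (hV.jostM_zero_analyticAt (by linarith [hV.nonneg])) ?_
  have hex : ∀ j, ∃ f g : ℝ → ℂ, j < m →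
      IsDirichletPair V (c (j + 1)) (k ^ 2 • c (j + 1) + c j) f g := fun j => by
    by_cases hj : j < m
    · obtain ⟨f, g, h⟩ := hc j hj
      exact ⟨f, g, fun _ => h⟩
    · exact ⟨0, 0, fun h => absurd h hj⟩
  choose f g hfg using hex
  have hg0 : g 0 0 ≠ 0 := by
    have := hfg 0 hm
    rw [h0, add_zero] at this
    exact hV.eigen_deriv_ne_zero this h1
  -- Halving the decay rate gives a majorant of `I_m` that is uniform for κ near `k`.
  set b := k.im / 2 with hb
  have hb0 : 0 < b := by positivity
  set C : ℝ := ∫ x in Ioi 0, ‖c m x‖ * (jostBound V η * Real.exp (-(b * x))) with hC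
  have hCint : IntegrableOn (fun x => ‖c m x‖ * (jostBound V η * Real.exp (-(b * x)))) (Ioi 0) :=
    (Lp.memLp (c m)).norm.integrable_mul (exp_memLp hb0)
  set G : ℂ → ℂ := fun κ => ∑ j ∈ Finset.range m, (κ ^ 2 - k ^ 2) ^ j * g j 0 with hG
  have hGcont : Continuous G := by fun_prop
  have hGk : G k = g 0 0 := by
    simp only [hG, sub_self]
    rw [Finset.sum_eq_single_of_mem 0 (Finset.mem_range.2 hm)]
    · simp
    · intro j _ hj
      simp [hj]
  have hG2 : ∀ᶠ κ in 𝓝 k, ‖g 0 0‖ / 2 < ‖G κ‖ := by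
    have := hGcont.norm.tendsto k
    rw [hGk] at this
    exact this.eventually_const_lt (half_lt_self (norm_pos_iff.2 hg0))
  have hadd : ∀ᶠ κ in 𝓝 k, ‖κ + k‖ < 2 * ‖k‖ + 1 := by
    have h2 : Tendsto (fun κ => ‖κ + k‖) (𝓝 k) (𝓝 ‖k + k‖) :=
      Continuous.tendsto (by fun_prop) k
    refine h2.eventually_lt_const ((norm_add_le _ _).trans_lt (by linarith))
  refine Asymptotics.IsBigO.of_bound ((2 * ‖k‖ + 1) ^ m * C / (‖g 0 0‖ / 2)) ?_
  filter_upwards [hG2, hadd, (isOpen_im_gt b).mem_nhds (show b < k.im by linarith)] with κ h2 h3 h4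
  have hκ : 0 < κ.im := hb0.trans h4
  have hsum : G κ * jostM V κ 0
      = -((κ ^ 2 - k ^ 2) ^ m * ∫ x in Ioi 0, c m x * jost V κ x) := by
    have hI0 : ∫ x in Ioi 0, c 0 x * jost V κ x = 0 := by
      rw [h0]
      refine (integral_congr_ae (g := fun _ => 0) ?_).trans (integral_zero _ _)
      filter_upwards [Lp.coeFn_zero ℂ 2 (volume.restrict (Ioi (0 : ℝ)))] with x hx
      rw [hx]
      simp
    have htel := Finset.sum_range_sub
      (fun j => -((κ ^ 2 - k ^ 2) ^ j * ∫ x in Ioi 0, c j x * jost V κ x)) m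
    rw [hI0, mul_zero, neg_zero, sub_zero] at htel
    rw [← htel, hG, Finset.sum_mul]
    refine Finset.sum_congr rfl fun j hj => ?_
    rw [mul_assoc, hV.deriv_mul_jost_zero_of_chain hκ (hfg j (Finset.mem_range.1 hj))]
    ring
  have hI : ‖∫ x in Ioi 0, c m x * jost V κ x‖ ≤ C := by
    refine norm_integral_le_of_norm_le hCint
      (ae_restrict_of_forall_mem measurableSet_Ioi fun x hx => ?_)
    have hx0 : 0 < x := hx
    rw [norm_mul]
    refine mul_le_mul_of_nonneg_left ((hV.norm_jost_le (by linarith [hV.nonneg]) hx0.le).trans ?_)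
      (norm_nonneg _)
    refine mul_le_mul_of_nonneg_left (Real.exp_le_exp.2 ?_) (Real.exp_nonneg _)
    have : b * x ≤ κ.im * x := mul_le_mul_of_nonneg_right (le_of_lt h4) hx0.le
    linarith
  have hnorm := congrArg norm hsum
  rw [norm_mul, norm_neg, norm_mul, show κ ^ 2 - k ^ 2 = (κ + k) * (κ - k) by ring, mul_pow,
    norm_mul, norm_pow] at hnorm
  rw [div_mul_eq_mul_div, le_div_iff₀ (by positivity)]
  calc ‖jostM V κ 0‖ * (‖g 0 0‖ / 2) ≤ ‖jostM V κ 0‖ * ‖G κ‖ := by gcongr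
    _ = ‖κ + k‖ ^ m * ‖(κ - k) ^ m‖ * ‖∫ x in Ioi 0, c m x * jost V κ x‖ := by
      rw [mul_comm, hnorm]
    _ ≤ (2 * ‖k‖ + 1) ^ m * ‖(κ - k) ^ m‖ * C := by gcongr
    _ = _ := by ring

/-- The algebraic multiplicity is at most the order of vanishing of the Jost function. -/
theorem algMultiplicity_le_analyticOrderAt (hV : ExpDecay V η) (hk : 0 < k.im) :
    algMultiplicity (schrodingerOp V) (k ^ 2) ≤ analyticOrderAt (fun κ => jostM V κ 0) k := by
  by_cases htop : analyticOrderAt (fun κ => jostM V κ 0) k = ⊤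
  · rw [htop]
    exact le_top
  obtain ⟨d, hd⟩ := ENat.ne_top_iff_exists.1 htop
  rw [← hd]
  refine algMultiplicity_le (fun u v hu hu' hv' => ?_) fun c hc0 hc1 hc => ?_
  · rw [schrodingerOp_graph] at hu' hv'
    obtain ⟨f₁, g₁, h₁⟩ := hu'
    obtain ⟨f₂, g₂, h₂⟩ := hv'
    obtain ⟨α₁, hα₁⟩ := hV.exists_eq_mul_jost hk.le h₁
    obtain ⟨α₂, hα₂⟩ := hV.exists_eq_mul_jost hk.le h₂
    have hα₁0 : α₁ ≠ 0 := by
      rintro rfl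
      exact hu (h₁.eq_zero fun x hx => by rw [hα₁ x hx, zero_mul])
    refine ⟨α₂ / α₁, Lp.ext ?_⟩
    filter_upwards [h₁.ae_eq, h₂.ae_eq, Lp.coeFn_smul (α₂ / α₁) u,
      ae_restrict_mem measurableSet_Ioi] with x e1 e2 e3 hx
    have hx0 : 0 ≤ x := le_of_lt hx
    rw [e3, Pi.smul_apply, e1, e2, hα₁ x hx0, hα₂ x hx0, smul_eq_mul]
    field_simp
  · rw [schrodingerOp_graph] at hc
    have := hV.le_analyticOrderAt_of_chain hk (Nat.succ_pos d) hc0 hc1 hc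
    rw [← hd, Nat.cast_le] at this
    omega

theorem eigenvalue_sq (hV : ExpDecay V η) {z : ℂ} (hz : IsEigenvalue (schrodingerOp V) z) :
    ∃ k : ℂ, k ^ 2 = z ∧ 0 < k.im ∧ jostM V k 0 = 0 := by
  obtain ⟨k, hk, hk0⟩ : ∃ k : ℂ, k ^ 2 = z ∧ 0 ≤ k.im := by
    obtain ⟨k, hk⟩ := IsAlgClosed.exists_pow_nat_eq z (n := 2) (by norm_num)
    rcases le_total 0 k.im with h | h
    · exact ⟨k, hk, h⟩
    · exact ⟨-k, by rw [neg_sq, hk], by simpa using h⟩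
  obtain ⟨u, hu, huz⟩ := hz
  have hmem := (schrodingerOp V).mem_graph u
  rw [schrodingerOp_graph, huz, ← hk] at hmem
  obtain ⟨f, g, h⟩ := hmem
  exact ⟨k, hk, hV.im_pos_and_jostM_eq_zero hk0 h hu⟩

end ExpDecay

/-! ### Counting zeros near the real axis -/

theorem divisor_eq_analyticOrderNatAt {f : ℂ → ℂ} {U : Set ℂ} {z : ℂ} (hf : AnalyticOnNhd ℂ f U)
    (hz : z ∈ U) : MeromorphicOn.divisor f U z = analyticOrderNatAt f z := by
  rw [MeromorphicOn.AnalyticOnNhd.divisor_apply hf hz, analyticOrderNatAt]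
  cases analyticOrderAt f z <;> simp

theorem cos_seven_pi_div_sixteen_pos : 0 < Real.cos (7 * Real.pi / 16) :=
  Real.cos_pos_of_mem_Ioo ⟨by linarith [Real.pi_pos], by linarith [Real.pi_pos]⟩

/-- On the right half-plane the argument of w^{-7/8} stays within 7π/16, strictly less than π/2, so
its real part is comparable with its modulus. This fails for the exponent -1. -/
theorem le_re_cpow {w : ℂ} (hw : 0 < w.re) :
    ‖w‖ ^ (-7 / 8 : ℝ) * Real.cos (7 * Real.pi / 16) ≤ (w ^ ((-7 / 8 : ℝ) : ℂ)).re := by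
  rw [Complex.cpow_ofReal_re]
  refine mul_le_mul_of_nonneg_left ?_ (by positivity)
  rw [← Real.cos_abs (w.arg * _), abs_mul]
  have h1 := (Complex.abs_arg_lt_pi_div_two_iff.2 (Or.inl hw)).le
  have h2 : |(-7 / 8 : ℝ)| = 7 / 8 := by norm_num [abs_of_neg]
  rw [h2]
  exact Real.cos_le_cos_of_nonneg_of_le_pi (by positivity) (by linarith [Real.pi_pos])
    (by linarith)

/-- The comparison function `K (2η - ik) ^ (-7/8)` for `η = 1 / R`. -/
noncomputable def majorantExponent (K R : ℝ) (k : ℂ) : ℂ :=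
  K * (((2 / R : ℝ) : ℂ) - Complex.I * k) ^ ((-7 / 8 : ℝ) : ℂ)

/-! ### A holomorphic function whose real part dominates the logarithm of the Jost function. -/

section Majorant

variable {C R : ℝ} {k : ℂ}

theorem re_shift (R : ℝ) (k : ℂ) : (((2 / R : ℝ) : ℂ) - Complex.I * k).re = 2 / R + k.im := by
  simp

theorem shift_re_ge (hk : -(1 / R) < k.im) :
    1 / R < (((2 / R : ℝ) : ℂ) - Complex.I * k).re := by
  rw [re_shift]
  have : 2 / R = 1 / R + 1 / R := by ring
  linarith

theorem majorantExponent_differentiableOn (hR : 1 ≤ R) (K : ℝ) :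
    DifferentiableOn ℂ (majorantExponent K R) {k | -(1 / R) < k.im} := by
  intro k hk
  have h1 := shift_re_ge hk
  have h2 : 0 < 1 / R := by positivity
  refine DifferentiableAt.differentiableWithinAt ?_
  unfold majorantExponent
  have h3 : DifferentiableAt ℂ (fun k : ℂ => ((2 / R : ℝ) : ℂ) - Complex.I * k) k := by fun_prop
  exact (h3.cpow (differentiableAt_const _) (Or.inl (h2.trans h1))).const_mul _

/-- On the strip |w| ≥ 1/R, so 1/|w| ≤ R^{1/8} |w|^{-7/8}: lowering the exponent costs only a factor
R^{1/8}. -/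
theorem le_re_majorantExponent (hC : 1 ≤ C) (hR : 1 ≤ R) (hk : -(1 / R) < k.im) :
    3 * C * R / ‖((2 / R : ℝ) : ℂ) - Complex.I * k‖
      ≤ (majorantExponent (3 * C * R * R ^ (1 / 8 : ℝ) / Real.cos (7 * Real.pi / 16)) R k).re := by
  have hc := cos_seven_pi_div_sixteen_pos
  have h1 := shift_re_ge hk
  have h2 : 0 < 1 / R := by positivity
  set w := ((2 / R : ℝ) : ℂ) - Complex.I * k with hw
  have hw1 : 1 / R ≤ ‖w‖ := h1.le.trans (Complex.re_le_norm w)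
  have hw0 : 0 < ‖w‖ := h2.trans_le hw1
  have h3 := le_re_cpow (h2.trans h1)
  have h4 : 1 ≤ ‖w‖ ^ (1 / 8 : ℝ) * R ^ (1 / 8 : ℝ) := by
    rw [← Real.mul_rpow hw0.le (by linarith)]
    refine Real.one_le_rpow ?_ (by norm_num)
    rwa [div_le_iff₀ (by linarith)] at hw1
  have h5 : ‖w‖ ^ (-7 / 8 : ℝ) = ‖w‖ ^ (1 / 8 : ℝ) / ‖w‖ := by
    rw [show (-7 / 8 : ℝ) = 1 / 8 - 1 by norm_num, Real.rpow_sub_one hw0.ne']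
  rw [majorantExponent, Complex.re_ofReal_mul]
  calc 3 * C * R / ‖w‖ ≤ 3 * C * R * (‖w‖ ^ (1 / 8 : ℝ) * R ^ (1 / 8 : ℝ)) / ‖w‖ := by
        refine div_le_div_of_nonneg_right ?_ hw0.le
        exact le_mul_of_one_le_right (by positivity) h4
    _ = 3 * C * R * R ^ (1 / 8 : ℝ) / Real.cos (7 * Real.pi / 16)
        * (‖w‖ ^ (-7 / 8 : ℝ) * Real.cos (7 * Real.pi / 16)) := by
        rw [h5]
        field_simp
    _ ≤ _ := by gcongr

/-- Here |w| ≤ 2/R + |k|, at most three times the larger of 1/R and |k|. A single expression thus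
dominates the bound near the origin and the one away from it. -/
theorem min_le_shift (hC : 1 ≤ C) (hR : 1 ≤ R) (hk : -(1 / R) < k.im) :
    (‖k‖ < 1 / R → C * R ^ 2 ≤ 3 * C * R / ‖((2 / R : ℝ) : ℂ) - Complex.I * k‖) ∧
    (1 / R ≤ ‖k‖ → C * R / ‖k‖ ≤ 3 * C * R / ‖((2 / R : ℝ) : ℂ) - Complex.I * k‖) := by
  have h1 := shift_re_ge hk
  have h2 : 0 < 1 / R := by positivity
  set w := ((2 / R : ℝ) : ℂ) - Complex.I * k with hw
  have hw0 : 0 < ‖w‖ := h2.trans_le (h1.le.trans (Complex.re_le_norm w))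
  have hw1 : ‖w‖ ≤ 2 / R + ‖k‖ := by
    refine (norm_sub_le _ _).trans_eq ?_
    rw [Complex.norm_real, Real.norm_of_nonneg (by positivity), norm_mul, Complex.norm_I, one_mul]
  have h3 : 2 / R = 2 * (1 / R) := by ring
  constructor
  · intro hlt
    rw [le_div_iff₀ hw0]
    calc C * R ^ 2 * ‖w‖ ≤ C * R ^ 2 * (3 * (1 / R)) := by
          gcongr
          linarith
      _ = 3 * C * R := by
          field_simp
  · intro hle
    have hk0 : 0 < ‖k‖ := h2.trans_le hle
    rw [div_le_div_iff₀ hk0 hw0]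
    calc C * R * ‖w‖ ≤ C * R * (3 * ‖k‖) := by
          gcongr
          linarith
      _ = 3 * C * R * ‖k‖ := by ring

end Majorant

theorem exp_sub_one_le_two_mul {t : ℝ} (h0 : 0 ≤ t) (h1 : t ≤ 1) : Real.exp t - 1 ≤ 2 * t := by
  have := Real.abs_exp_sub_one_le (x := t) (by rwa [abs_of_nonneg h0])
  rw [abs_of_nonneg h0] at this
  exact (le_abs_self _).trans this

theorem neg_log_norm_le {ζ : ℂ} {t : ℝ} (h0 : 0 ≤ t) (h1 : t ≤ 1 / 8)
    (h : ‖ζ - 1‖ ≤ Real.exp t - 1) : ζ ≠ 0 ∧ -Real.log ‖ζ‖ ≤ 4 * t := by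
  have h2 := exp_sub_one_le_two_mul h0 (by linarith)
  have h3 : 1 - 2 * t ≤ ‖ζ‖ := by
    have := norm_sub_norm_le (1 : ℂ) ζ
    rw [norm_one, norm_sub_rev] at this
    linarith
  have h4 : 0 < ‖ζ‖ := by linarith
  refine ⟨norm_pos_iff.1 h4, ?_⟩
  have h5 := Real.one_sub_inv_le_log_of_pos h4
  have h6 : ‖ζ‖⁻¹ ≤ 1 + 4 * t := by
    rw [inv_le_iff_one_le_mul₀ h4]
    nlinarith
  linarith

/-- A quantitative bound for the zeros of `F` in the closed upper half-plane, when `F - 1` is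
small at infinity and `log |F|` is controlled on the strip `Im k > -1 / R`. -/
theorem sum_analyticOrderNatAt_le {F : ℂ → ℂ} {C R : ℝ} (hC : 1 ≤ C) (hR : 1 ≤ R)
    (hF : DifferentiableOn ℂ F {k | -(1 / R) < k.im})
    (h0 : ∀ k : ℂ, -(1 / R) < k.im → ‖F k‖ ≤ Real.exp (C * R ^ 2))
    (h1 : ∀ k : ℂ, -(1 / R) < k.im → k ≠ 0 → ‖F k - 1‖ ≤ Real.exp (C * R / ‖k‖) - 1) :
    (∀ k : ℂ, -(1 / R) < k.im → analyticOrderAt F k ≠ ⊤) ∧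
    ∀ s : Finset ℂ, (∀ k ∈ s, 0 < k.im ∧ F k = 0) →
      ∑ k ∈ s, (analyticOrderNatAt F k : ℝ) ≤
        64 * C ^ 2 * (3 * C / Real.cos (7 * Real.pi / 16) + 1) * (R ^ 4 * R ^ (-3 / 2 : ℝ)) := by
  have hR0 : 0 < R := by linarith
  have hC0 : 0 < C := by linarith
  have hcos := cos_seven_pi_div_sixteen_pos
  have hη : 0 < 1 / R := by positivity
  have hη1 : 1 / R ≤ 1 := by rw [div_le_one hR0]; exact hR
  set S : Set ℂ := {k | -(1 / R) < k.im} with hS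
  have hSo : IsOpen S := isOpen_im_gt _
  have hFan : AnalyticOnNhd ℂ F S := hF.analyticOnNhd hSo
  -- This radius makes the disc about `I * r` flat enough at the origin: enlarging it by `1 / (4 R)`
  -- adds at least `r / (2 R) = (2 C R) ^ 2` to the squared radius, enough to contain the upper half
  -- of the disc `‖k‖ ≤ 2 C R`, where all zeros lie.
  set r : ℝ := 8 * C ^ 2 * R ^ 3 with hr
  have hr1 : R ^ 3 ≤ r := by
    have : (1 : ℝ) ≤ 8 * C ^ 2 := by nlinarith
    exact le_mul_of_one_le_left (by positivity) this
  have hr0 : 0 < r := by positivity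
  have hr2 : 1 ≤ r := (one_le_pow₀ hR).trans hr1
  set c : ℂ := Complex.I * r with hc
  have hcnorm : ‖c‖ = r := by
    rw [hc, norm_mul, Complex.norm_I, one_mul, Complex.norm_real, Real.norm_of_nonneg hr0.le]
  have hcim : c.im = r := by simp [hc]
  have hcre : c.re = 0 := by simp [hc]
  have hc0 : c ≠ 0 := norm_pos_iff.1 (by rw [hcnorm]; exact hr0)
  have hcS : c ∈ S := by
    simp only [hS, mem_ofPred_eq, hcim]
    linarith
  set t : ℝ := C * R / ‖c‖ with ht
  have ht' : t = 1 / (8 * C * R ^ 2) := by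
    rw [ht, hcnorm, hr]
    field_simp
  have hR2 : 1 ≤ R ^ 2 := one_le_pow₀ hR
  have ht1 : t ≤ 1 / 8 := by
    rw [ht', div_le_div_iff₀ (by positivity) (by norm_num)]
    nlinarith
  have ht0 : 0 ≤ t := by positivity
  obtain ⟨hFc0, hFc⟩ := neg_log_norm_le ht0 ht1 (h1 c hcS hc0)
  have hpre : IsPreconnected S := (convex_halfSpace_im_gt _).isPreconnected
  -- `F` is nonzero at the centre `c`, and the strip is connected, so no zero has infinite order.
  have hfin : ∀ k ∈ S, analyticOrderAt F k ≠ ⊤ := fun k hk =>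
    hFan.analyticOrderAt_ne_top_of_isPreconnected hpre hcS hk
      (by rw [(hFan c hcS).analyticOrderAt_eq_zero.2 hFc0]; simp)
  refine ⟨hfin, fun s hs => ?_⟩
  set K : ℝ := 3 * C * R * R ^ (1 / 8 : ℝ) / Real.cos (7 * Real.pi / 16) with hK
  set h : ℂ → ℂ := majorantExponent K R with hh
  have hhan : AnalyticOnNhd ℂ h S :=
    (majorantExponent_differentiableOn hR K).analyticOnNhd hSo
  set e : ℂ → ℂ := fun k => Complex.exp (-h k) with he
  have hean : AnalyticOnNhd ℂ e S := fun k hk => (hhan k hk).neg.cexp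
  have he0 : ∀ k ∈ S, analyticOrderAt e k = 0 := fun k hk =>
    (hean k hk).analyticOrderAt_eq_zero.2 (Complex.exp_ne_zero _)
  have hfan : AnalyticOnNhd ℂ (F * e) S := fun k hk => (hFan k hk).mul (hean k hk)
  have hord : ∀ k ∈ S, analyticOrderNatAt (F * e) k = analyticOrderNatAt F k := fun k hk => by
    rw [analyticOrderNatAt, analyticOrderAt_mul (hFan k hk) (hean k hk), he0 k hk, add_zero,
      analyticOrderNatAt]
  have hnormf : ∀ k, ‖(F * e) k‖ = ‖F k‖ * Real.exp (-(h k).re) := fun k => by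
    simp [he, Complex.norm_exp]
  -- Multiplying by `exp (-h)` keeps the zeros with their orders and lowers the supremum to `1`, so
  -- only the value at the centre enters Jensen's bound.
  have hbound : ∀ k ∈ S, ‖(F * e) k‖ ≤ 1 := by
    intro k hk
    have h2 := le_re_majorantExponent hC hR hk
    have h3 := min_le_shift hC hR hk
    have h4 : ‖F k‖ ≤ Real.exp (h k).re := by
      rcases lt_or_ge ‖k‖ (1 / R) with hlt | hge
      · exact (h0 k hk).trans (Real.exp_le_exp.2 ((h3.1 hlt).trans h2))
      · have hk0 : k ≠ 0 := norm_pos_iff.1 (hη.trans_le hge)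
        refine le_trans ?_ (Real.exp_le_exp.2 ((h3.2 hge).trans h2))
        have h5 := h1 k hk hk0
        have h6 := norm_sub_norm_le (F k) 1
        rw [norm_one] at h6
        linarith
    rw [hnormf]
    calc ‖F k‖ * Real.exp (-(h k).re) ≤ Real.exp (h k).re * Real.exp (-(h k).re) := by gcongr
      _ = 1 := by rw [← Real.exp_add, add_neg_cancel, Real.exp_zero]
  have hball : ∀ ρ, ρ ≤ r + 1 / R / 2 → Metric.closedBall c ρ ⊆ S := by
    intro ρ hρ k hk
    rw [Metric.mem_closedBall, dist_eq_norm] at hk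
    have h2 := (Complex.abs_im_le_norm (k - c)).trans hk
    rw [Complex.sub_im, hcim] at h2
    have h3 := neg_abs_le (k.im - r)
    simp only [hS, mem_ofPred_eq]
    linarith
  -- Both radii stay below `r + 1 / R`, so the two discs lie inside the strip of analyticity.
  set r₁ : ℝ := r + 1 / R / 4 with hr₁
  set r₂ : ℝ := r + 1 / R / 2 with hr₂
  have hr₁0 : 0 < r₁ := by positivity
  have hr₂0 : 0 < r₂ := by positivity
  have hr12 : r₁ < r₂ := by
    rw [hr₁, hr₂]
    linarith
  have hfc0 : (F * e) c ≠ 0 := mul_ne_zero hFc0 (Complex.exp_ne_zero _)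
  have hB₁ := hball r₁ hr12.le
  have hJ := AnalyticOnNhd.sum_divisor_le (c := c) (r := r₁) (R := r₂) (M := 1) (f := F * e)
    (by rwa [abs_of_pos hr₁0]) (by rwa [abs_of_pos hr₁0, abs_of_pos hr₂0]) le_rfl
    (by rw [abs_of_pos hr₂0]; exact hfan.mono (hball r₂ le_rfl)) hfc0
    (by
      rw [abs_of_pos hr₂0]
      exact fun z hz => hbound z (hball r₂ le_rfl (Metric.sphere_subset_closedBall hz)))
  rw [abs_of_pos hr₁0] at hJ
  have hsub : ∀ k ∈ s, k ∈ Metric.closedBall c r₁ := by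
    intro k hk
    obtain ⟨hk1, hk2⟩ := hs k hk
    have hkS : k ∈ S := by
      simp only [hS, mem_ofPred_eq]
      linarith
    -- At a zero, `1 ≤ exp (C R / ‖k‖) - 1`, which is impossible when `C R / ‖k‖ < 1 / 2`.
    have hkA : ‖k‖ ≤ 2 * C * R := by
      by_contra! hlt
      have hk0 : 0 < ‖k‖ := lt_trans (by positivity) hlt
      have h2 := h1 k hkS (norm_pos_iff.1 hk0)
      have h3 : C * R / ‖k‖ < 1 / 2 := by
        rw [div_lt_div_iff₀ hk0 (by norm_num)]
        linarith
      rw [hk2, zero_sub, norm_neg, norm_one] at h2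
      have := exp_sub_one_le_two_mul (t := C * R / ‖k‖) (by positivity) (by linarith)
      linarith
    rw [Metric.mem_closedBall, dist_eq_norm]
    refine abs_le_of_sq_le_sq' ?_ hr₁0.le |>.2
    have h2 : ‖k - c‖ ^ 2 = ‖k‖ ^ 2 - 2 * r * k.im + r ^ 2 := by
      rw [← Complex.normSq_eq_norm_sq, ← Complex.normSq_eq_norm_sq, Complex.normSq_apply,
        Complex.normSq_apply, Complex.sub_re, Complex.sub_im, hcre, hcim]
      ring
    have h3 : ‖k‖ ^ 2 ≤ (2 * C * R) ^ 2 := by gcongr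
    have h4 : r * (1 / R) = 8 * C ^ 2 * R ^ 2 := by
      rw [hr]
      field_simp
    have h5 : 0 ≤ r * k.im := by positivity
    have h6 : r₁ ^ 2 = r ^ 2 + r * (1 / R) / 2 + (1 / R / 4) ^ 2 := by
      rw [hr₁]
      ring
    rw [h2, h6, h4]
    nlinarith [sq_nonneg (1 / R / 4)]
  have hsum : ∑ k ∈ s, (analyticOrderNatAt F k : ℤ)
      ≤ ∑ᶠ u, MeromorphicOn.divisor (F * e) (Metric.closedBall c r₁) u := by
    have hfsupp := (MeromorphicOn.divisor (F * e) (Metric.closedBall c r₁)).finiteSupport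
      (isCompact_closedBall c r₁)
    have hnn := MeromorphicOn.AnalyticOnNhd.divisor_nonneg (hfan.mono hB₁)
    rw [finsum_eq_sum_of_support_subset (s := s ∪ hfsupp.toFinset) _ (by
      intro u hu
      simp only [Finset.coe_union, Set.Finite.coe_toFinset]
      exact Or.inr hu)]
    calc ∑ k ∈ s, (analyticOrderNatAt F k : ℤ)
        = ∑ k ∈ s, MeromorphicOn.divisor (F * e) (Metric.closedBall c r₁) k := by
          refine Finset.sum_congr rfl fun k hk => ?_
          rw [divisor_eq_analyticOrderNatAt (hfan.mono hB₁) (hsub k hk), hord k (hB₁ (hsub k hk))]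
      _ ≤ _ := Finset.sum_le_sum_of_subset_of_nonneg Finset.subset_union_left
          fun k _ _ => hnn k
  -- Powers of `R`: the prefactor contributes `1 + 1/8` and `r ^ (-7/8)` at most `-21/8`, giving
  -- `-3/2`. The contribution of `F c` itself is of order `R ^ (-2)`.
  have hlogc : Real.log (1 / ‖(F * e) c‖)
      ≤ (3 * C / Real.cos (7 * Real.pi / 16) + 1) * R ^ (-3 / 2 : ℝ) := by
    rw [one_div, Real.log_inv, hnormf, Real.log_mul (norm_ne_zero_iff.2 hFc0) (Real.exp_ne_zero _),
      Real.log_exp]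
    have h2 : (h c).re ≤ 3 * C / Real.cos (7 * Real.pi / 16) * R ^ (-3 / 2 : ℝ) := by
      have hw : ((2 / R : ℝ) : ℂ) - Complex.I * c = ((2 / R + r : ℝ) : ℂ) := by
        rw [hc, ← mul_assoc, Complex.I_mul_I]
        push_cast
        ring
      have h3 : (h c).re = K * (2 / R + r) ^ (-7 / 8 : ℝ) := by
        rw [hh, majorantExponent, hw, Complex.re_ofReal_mul,
          ← Complex.ofReal_cpow (by positivity), Complex.ofReal_re]
      rw [h3]
      calc K * (2 / R + r) ^ (-7 / 8 : ℝ) ≤ K * (R ^ 3) ^ (-7 / 8 : ℝ) := by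
            refine mul_le_mul_of_nonneg_left ?_ (by positivity)
            refine Real.rpow_le_rpow_of_nonpos (by positivity) ?_ (by norm_num)
            have : 0 ≤ 2 / R := by positivity
            linarith
        _ = 3 * C / Real.cos (7 * Real.pi / 16)
            * (R * R ^ (1 / 8 : ℝ) * (R ^ 3) ^ (-7 / 8 : ℝ)) := by
            rw [hK]
            ring
        _ = _ := by
            congr 1
            rw [← Real.rpow_natCast R 3, ← Real.rpow_mul hR0.le]
            nth_rewrite 1 [← Real.rpow_one R]
            rw [← Real.rpow_add hR0, ← Real.rpow_add hR0]
            norm_num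
    have h3 : 4 * t ≤ R ^ (-3 / 2 : ℝ) := by
      have h4 : R ^ (-2 : ℝ) ≤ R ^ (-3 / 2 : ℝ) :=
        Real.rpow_le_rpow_of_exponent_le hR (by norm_num)
      have h5 : R ^ (-2 : ℝ) = 1 / R ^ 2 := by
        rw [Real.rpow_neg hR0.le, Real.rpow_two, one_div]
      rw [h5] at h4
      refine le_trans ?_ h4
      rw [ht', ← mul_div_assoc, div_le_div_iff₀ (by positivity) (by positivity)]
      nlinarith
    linarith
  -- From `log y ≥ 1 - 1 / y` and `r₂ ≤ 2 r`.
  have hlogr : 1 / (64 * C ^ 2 * R ^ 4) ≤ Real.log (r₂ / r₁) := by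
    have h2 := Real.one_sub_inv_le_log_of_pos (div_pos hr₂0 hr₁0)
    refine le_trans ?_ h2
    have h3 : 1 - (r₂ / r₁)⁻¹ = 1 / R / 4 / r₂ := by
      rw [inv_div, hr₁, hr₂]
      field_simp
      ring
    rw [h3]
    calc 1 / (64 * C ^ 2 * R ^ 4) = 1 / R / 4 / (2 * r) := by
          rw [hr]
          field_simp
          norm_num
      _ ≤ 1 / R / 4 / r₂ := by
          refine div_le_div_of_nonneg_left (by positivity) hr₂0 ?_
          rw [hr₂]
          linarith
  have hlogr0 : 0 < Real.log (r₂ / r₁) := lt_of_lt_of_le (by positivity) hlogr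
  have hsum' : ∑ k ∈ s, (analyticOrderNatAt F k : ℝ)
      ≤ Real.log (1 / ‖(F * e) c‖) / Real.log (r₂ / r₁) := by
    refine le_trans ?_ hJ
    exact_mod_cast hsum
  refine hsum'.trans ?_
  rw [div_le_iff₀ hlogr0]
  refine hlogc.trans ?_
  have hpos : 0 ≤ (3 * C / Real.cos (7 * Real.pi / 16) + 1) * R ^ (-3 / 2 : ℝ) := by positivity
  calc (3 * C / Real.cos (7 * Real.pi / 16) + 1) * R ^ (-3 / 2 : ℝ)
      = (64 * C ^ 2 * (3 * C / Real.cos (7 * Real.pi / 16) + 1) * (R ^ 4 * R ^ (-3 / 2 : ℝ)))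
        * (1 / (64 * C ^ 2 * R ^ 4)) := by
        field_simp
    _ ≤ _ := by gcongr

/-! ### The dissipative barrier -/

/-- The potential `q + i γ χ_{[0,R]}`. -/
noncomputable def barrierPotential (q : ℝ → ℂ) (γ R : ℝ) (x : ℝ) : ℂ :=
  q x + (Icc 0 R).indicator (fun _ => Complex.I * (γ : ℂ)) x

theorem dissipativeOp_eq (q : ℝ → ℂ) (γ R : ℝ) :
    dissipativeOp q γ R = schrodingerOp (barrierPotential q γ R) := rfl

section Barrier

variable {q : ℝ → ℂ} {γ a R η : ℝ}

theorem norm_barrierPotential_le (hγ : 0 ≤ γ) (t : ℝ) :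
    ‖barrierPotential q γ R t‖ ≤ ‖q t‖ + (Icc 0 R).indicator (fun _ => γ) t := by
  refine (norm_add_le _ _).trans (add_le_add le_rfl ?_)
  by_cases ht : t ∈ Icc 0 R <;> simp [ht, abs_of_nonneg hγ]

theorem barrierPotential_aestronglyMeasurable (hq : IntegrableOn q (Ioi 0)) :
    AEStronglyMeasurable (barrierPotential q γ R) (volume.restrict (Ioi 0)) :=
  hq.aestronglyMeasurable.add (aestronglyMeasurable_const.indicator measurableSet_Icc)

theorem integrableOn_add_indicator {F : ℝ → ℝ} (hF : IntegrableOn F (Ioi 0)) (hR : 0 ≤ R) (c : ℝ) :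
    IntegrableOn (fun t => F t + (Icc 0 R).indicator (fun _ => c) t) (Ioi 0) ∧
      ∫ t in Ioi 0, (F t + (Icc 0 R).indicator (fun _ => c) t) = (∫ t in Ioi 0, F t) + c * R := by
  have h1 : IntegrableOn ((Icc 0 R).indicator fun _ : ℝ => c) (Ioi 0) :=
    ((integrableOn_const (μ := volume) (s := Icc 0 R) (by simp)).integrable_indicator
      measurableSet_Icc).integrableOn
  have h2 : Ioi (0 : ℝ) ∩ Icc 0 R = Ioc 0 R := by
    ext t
    simp only [mem_inter_iff, mem_Ioi, mem_Icc, mem_Ioc]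
    exact ⟨fun h => ⟨h.1, h.2.2⟩, fun h => ⟨h.1, h.1.le, h.2⟩⟩
  refine ⟨hF.add h1, ?_⟩
  rw [integral_add hF h1, setIntegral_indicator measurableSet_Icc, h2]
  simp [hR, mul_comm]

/-- A pointwise bound for weighted barrier potentials. -/
theorem mul_norm_barrierPotential_le (hγ : 0 ≤ γ) {t w₁ w₂ : ℝ} {w : ℝ} (hw : 0 ≤ w) (h₁ : w ≤ w₁)
    (h₂ : t ∈ Icc 0 R → w ≤ w₂) :
    w * ‖barrierPotential q γ R t‖ ≤ w₁ * ‖q t‖ + (Icc 0 R).indicator (fun _ => w₂ * γ) t := by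
  refine (mul_le_mul_of_nonneg_left (norm_barrierPotential_le hγ t) hw).trans ?_
  rw [mul_add]
  refine add_le_add (mul_le_mul_of_nonneg_right h₁ (norm_nonneg _)) ?_
  by_cases ht : t ∈ Icc 0 R
  · simpa [ht] using mul_le_mul_of_nonneg_right (h₂ ht) hγ
  · simp [ht]

/-- Half of the Naimark weight covers the exponential growth of the kernel in the lower half-plane;
the other half absorbs the first moment. -/
theorem one_add_mul_exp_le (ha : 0 < a) (hηa : η ≤ a) {t : ℝ} (ht : 0 ≤ t) :
    Real.exp (2 * η * t) * (1 + t) ≤ (1 + 1 / (2 * a)) * Real.exp (4 * a * t) := by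
  have h1 : Real.exp (2 * η * t) ≤ Real.exp (2 * a * t) := by gcongr
  have h2 : 1 + t ≤ (1 + 1 / (2 * a)) * Real.exp (2 * a * t) := by
    have h3 := Real.add_one_le_exp (2 * a * t)
    have h4 : t = 1 / (2 * a) * (2 * a * t) := by field_simp
    have h5 : 0 < 1 / (2 * a) := by positivity
    have h6 : 0 ≤ 2 * a * t := by positivity
    nlinarith
  calc Real.exp (2 * η * t) * (1 + t)
      ≤ Real.exp (2 * a * t) * ((1 + 1 / (2 * a)) * Real.exp (2 * a * t)) := by gcongr
    _ = (1 + 1 / (2 * a)) * (Real.exp (2 * a * t) * Real.exp (2 * a * t)) := by ring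
    _ = _ := by rw [← Real.exp_add]; ring_nf

theorem barrier_expDecay (hγ : 0 ≤ γ) (ha : 0 < a) (hq : IntegrableOn q (Ioi 0))
    (hN : IntegrableOn (fun t : ℝ => Real.exp (4 * a * t) * ‖q t‖) (Ioi 0)) (hη : 0 ≤ η)
    (hηa : η ≤ a) (hR : 0 ≤ R) : ExpDecay (barrierPotential q γ R) η := by
  refine ⟨hη, barrierPotential_aestronglyMeasurable hq, ?_⟩
  refine Integrable.mono' (integrableOn_add_indicator (hN.const_mul (1 + 1 / (2 * a))) hR
    (Real.exp (2 * η * R) * (1 + R) * γ)).1 ?_ ?_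
  · exact AEStronglyMeasurable.mul (Continuous.aestronglyMeasurable (by fun_prop))
      (barrierPotential_aestronglyMeasurable hq).norm
  · refine ae_restrict_of_forall_mem measurableSet_Ioi fun t ht => ?_
    have ht0 : 0 < t := ht
    rw [Real.norm_of_nonneg (by positivity), ← mul_assoc]
    refine mul_norm_barrierPotential_le hγ (by positivity) (one_add_mul_exp_le ha hηa ht0.le)
      fun h => ?_
    have := h.2
    gcongr

/-- Bounds for the Jost function of the barrier potential on the strip `Im k ≥ -1 / R`. -/
theorem exists_barrier_bound (hγ : 0 ≤ γ) (ha : 0 < a) (hq : IntegrableOn q (Ioi 0))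
    (hN : IntegrableOn (fun t : ℝ => Real.exp (4 * a * t) * ‖q t‖) (Ioi 0)) :
    ∃ C : ℝ, 1 ≤ C ∧ ∀ R : ℝ, 1 ≤ R → 1 / a ≤ R → ∀ k : ℂ, -(1 / R) ≤ k.im →
      ‖jostM (barrierPotential q γ R) k 0‖ ≤ Real.exp (C * R ^ 2) ∧
      (k ≠ 0 → ‖jostM (barrierPotential q γ R) k 0 - 1‖ ≤ Real.exp (C * R / ‖k‖) - 1) := by
  set Q : ℝ := ∫ t in Ioi 0, Real.exp (4 * a * t) * ‖q t‖ with hQ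
  have hQ0 : 0 ≤ Q := setIntegral_nonneg measurableSet_Ioi fun t _ => by positivity
  set κ : ℝ := 1 + 1 / (2 * a) with hκ
  have hκ1 : 1 ≤ κ := by
    have : 0 < 1 / (2 * a) := by positivity
    linarith
  refine ⟨κ * Q + Real.exp 2 * γ + 1, ?_, fun R hR hRa k hk => ?_⟩
  · have : 0 ≤ κ * Q + Real.exp 2 * γ := by positivity
    linarith
  have hR0 : 0 < R := by linarith
  have hη0 : 0 ≤ 1 / R := by positivity
  have hηa : 1 / R ≤ a := by
    rw [div_le_iff₀ hR0]
    rwa [div_le_iff₀ ha, mul_comm] at hRa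
  have hV := barrier_expDecay (γ := γ) hγ ha hq hN hη0 hηa hR0.le
  set V := barrierPotential q γ R
  have hexpR : ∀ t ∈ Icc 0 R, Real.exp (2 * (1 / R) * t) ≤ Real.exp 2 := fun t ht => by
    refine Real.exp_le_exp.2 ?_
    rw [mul_assoc, one_div, inv_mul_eq_div]
    have : t / R ≤ 1 := (div_le_one hR0).2 ht.2
    linarith
  have hRR : R ≤ R ^ 2 := le_self_pow₀ hR two_ne_zero
  constructor
  -- On the barrier `t ≤ R`, so the kernel is at most `exp 2 * R`; integrating over length `R` gives
  -- the quadratic exponent.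
  · obtain ⟨hi, he⟩ := integrableOn_add_indicator (R := R) (hN.const_mul κ) hR0.le
      (Real.exp 2 * R * γ)
    have hρ : IsJostWeight V k fun t => κ * (Real.exp (4 * a * t) * ‖q t‖)
        + (Icc 0 R).indicator (fun _ => Real.exp 2 * R * γ) t := by
      refine ⟨hi, fun x t hx hxt => ?_⟩
      have ht0 : 0 < t := hx.trans_lt hxt
      have h1 := norm_phaseInt_le hη0 hk (sub_nonneg.2 hxt.le)
      have h2 : ‖phaseInt k (t - x)‖ ≤ Real.exp (2 * (1 / R) * t) * t := by
        refine h1.trans ?_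
        rw [mul_comm]
        gcongr <;> linarith
      rw [← mul_assoc]
      refine mul_norm_barrierPotential_le hγ (norm_nonneg _) (h2.trans ?_) fun h => h2.trans ?_
      · refine le_trans ?_ (one_add_mul_exp_le ha hηa ht0.le)
        gcongr
        linarith
      · have h3 := hexpR t h
        have h4 := h.2
        gcongr
    refine (hρ.norm_jostM_le hV hk le_rfl).trans (Real.exp_le_exp.2 ?_)
    rw [he, integral_const_mul, ← hQ]
    have h1 : κ * Q ≤ κ * Q * R ^ 2 := le_mul_of_one_le_right (by positivity) (by linarith)
    have h2 : 0 ≤ R ^ 2 := by positivity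
    linarith
  · intro hk0
    have hk1 : 0 < ‖k‖ := norm_pos_iff.2 hk0
    -- With the kernel bound `exp 2 / ‖k‖` in place of `exp 2 * R`, the barrier contributes only `R
    -- / ‖k‖`.
    obtain ⟨hi, he⟩ := integrableOn_add_indicator (R := R) (hN.const_mul ‖k‖⁻¹) hR0.le
      (Real.exp 2 / ‖k‖ * γ)
    have hρ : IsJostWeight V k fun t => ‖k‖⁻¹ * (Real.exp (4 * a * t) * ‖q t‖)
        + (Icc 0 R).indicator (fun _ => Real.exp 2 / ‖k‖ * γ) t := by
      refine ⟨hi, fun x t hx hxt => ?_⟩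
      have ht0 : 0 < t := hx.trans_lt hxt
      have h1 := norm_mul_phaseInt_le hη0 hk (sub_nonneg.2 hxt.le)
      have h2 : ‖phaseInt k (t - x)‖ ≤ Real.exp (2 * (1 / R) * t) / ‖k‖ := by
        rw [le_div_iff₀ hk1, mul_comm]
        refine h1.trans ?_
        gcongr
        linarith
      rw [← mul_assoc]
      refine mul_norm_barrierPotential_le hγ (norm_nonneg _) (h2.trans ?_) fun h => h2.trans ?_
      · rw [inv_mul_eq_div]
        gcongr
        linarith
      · have h3 := hexpR t h
        gcongr
    refine (hρ.norm_jostM_sub_one_le hV hk le_rfl).trans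
      (sub_le_sub_right (Real.exp_le_exp.2 ?_) 1)
    rw [he, integral_const_mul, ← hQ]
    have h1 : Q ≤ κ * Q * R := by
      calc Q ≤ κ * Q := le_mul_of_one_le_left hQ0 hκ1
        _ ≤ κ * Q * R := le_mul_of_one_le_right (by positivity) hR
    calc ‖k‖⁻¹ * Q + Real.exp 2 / ‖k‖ * γ * R = (Q + Real.exp 2 * γ * R) / ‖k‖ := by
          field_simp
      _ ≤ _ := by
          gcongr
          linarith

theorem numEigenvalues_le (hγ : 0 ≤ γ) (ha : 0 < a) (hq : IntegrableOn q (Ioi 0))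
    (hN : IntegrableOn (fun t : ℝ => Real.exp (4 * a * t) * ‖q t‖) (Ioi 0)) :
    ∃ C : ℝ, ∀ R : ℝ, 1 ≤ R → 1 / a ≤ R →
      numEigenvalues (dissipativeOp q γ R) ≤ ENNReal.ofReal (C * (R ^ 4 * R ^ (-3 / 2 : ℝ))) := by
  obtain ⟨C, hC, hbound⟩ := exists_barrier_bound hγ ha hq hN
  refine ⟨64 * C ^ 2 * (3 * C / Real.cos (7 * Real.pi / 16) + 1), fun R hR hRa => ?_⟩
  have hR0 : 0 < R := by linarith
  have hη0 : 0 ≤ 1 / R := by positivity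
  have hηa : 1 / R ≤ a := by
    rw [div_le_iff₀ hR0]
    rwa [div_le_iff₀ ha, mul_comm] at hRa
  have hV := barrier_expDecay (γ := γ) hγ ha hq hN hη0 hηa hR0.le
  obtain ⟨hfin, hsum⟩ := sum_analyticOrderNatAt_le hC hR (hV.jostM_differentiableOn le_rfl)
    (fun k hk => (hbound R hR hRa k (le_of_lt hk)).1)
    (fun k hk => (hbound R hR hRa k (le_of_lt hk)).2)
  rw [dissipativeOp_eq, numEigenvalues, ENNReal.tsum_eq_iSup_sum]
  refine iSup_le fun s => ?_
  -- Distinct eigenvalues have distinct square roots, so a finite sum of multiplicities becomes a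
  -- finite sum of orders of zeros; `numEigenvalues` is the supremum of such sums.
  choose κ hκ hκim hκ0 using fun z : {z : ℂ // IsEigenvalue
    (schrodingerOp (barrierPotential q γ R)) z} => hV.eigenvalue_sq z.2
  have hinj : Function.Injective κ := fun z w h => Subtype.ext (by rw [← hκ z, ← hκ w, h])
  have h1 := hsum (s.map ⟨κ, hinj⟩) (by
    simp only [Finset.mem_map, Function.Embedding.coeFn_mk]
    rintro _ ⟨z, _, rfl⟩
    exact ⟨hκim z, hκ0 z⟩)
  rw [Finset.sum_map] at h1
  refine le_trans ?_ (ENNReal.ofReal_le_ofReal h1)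
  rw [ENNReal.ofReal_sum_of_nonneg fun _ _ => Nat.cast_nonneg _]
  refine Finset.sum_le_sum fun z _ => ?_
  have h2 := hV.algMultiplicity_le_analyticOrderAt (hκim z)
  rw [hκ z, ← Nat.cast_analyticOrderNatAt (hfin (κ z) (by linarith [hκim z]))] at h2
  rw [ENNReal.ofReal_natCast]
  exact (ENat.toENNReal_le.2 h2).trans_eq (ENat.toENNReal_coe _)

/-- The left side is of order R^{5/2}, and log R = o(R^{1/4}) leaves room for log² R. -/
theorem eventually_le_cube_div_log_sq (C : ℝ) {c : ℝ} (hc : 0 < c) :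
    ∀ᶠ R : ℝ in atTop, C * (R ^ 4 * R ^ (-3 / 2 : ℝ)) ≤ c * (R ^ 3 / Real.log R ^ 2) := by
  have h1 := (isLittleO_log_rpow_atTop (r := 1 / 4) (by norm_num)).bound
    (c := Real.sqrt (c / (|C| + 1))) (by positivity)
  filter_upwards [h1, eventually_gt_atTop 1] with R hR hR1
  have hR0 : 0 < R := by linarith
  have hlog : 0 < Real.log R := Real.log_pos hR1
  rw [Real.norm_of_nonneg hlog.le, Real.norm_of_nonneg (by positivity)] at hR
  have h2 : Real.log R ^ 2 ≤ c / (|C| + 1) * R ^ (1 / 2 : ℝ) := by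
    calc Real.log R ^ 2 ≤ (Real.sqrt (c / (|C| + 1)) * R ^ (1 / 4 : ℝ)) ^ 2 := by gcongr
      _ = _ := by
        rw [mul_pow, Real.sq_sqrt (by positivity), ← Real.rpow_natCast (R ^ (1 / 4 : ℝ)) 2,
          ← Real.rpow_mul hR0.le]
        norm_num
  rw [← mul_div_assoc, le_div_iff₀ (by positivity)]
  have h3 : R ^ 4 * R ^ (-3 / 2 : ℝ) * R ^ (1 / 2 : ℝ) = R ^ 3 := by
    rw [← Real.rpow_natCast R 4, ← Real.rpow_natCast R 3, ← Real.rpow_add hR0,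
      ← Real.rpow_add hR0]
    norm_num
  calc C * (R ^ 4 * R ^ (-3 / 2 : ℝ)) * Real.log R ^ 2
      ≤ (|C| + 1) * (R ^ 4 * R ^ (-3 / 2 : ℝ)) * (c / (|C| + 1) * R ^ (1 / 2 : ℝ)) := by
        gcongr
        linarith [le_abs_self C]
    _ = c * (R ^ 4 * R ^ (-3 / 2 : ℝ) * R ^ (1 / 2 : ℝ)) := by
        field_simp
    _ = c * R ^ 3 := by rw [h3]

end Barrier

/-! ### Enclosure of the eigenvalues -/

/-- A square root of `k² - iγ` in the closed upper half-plane that is close to `k`, unless `k²`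
lies in the half-strip. -/
theorem exists_sqrt_near {γ : ℝ} (hγ : 0 < γ) {k : ℂ} (hk : 0 < k.im)
    (hz : k ^ 2 ∉ halfStrip γ) :
    ∃ κ : ℂ, κ ^ 2 = k ^ 2 - Complex.I * γ ∧ 0 ≤ κ.im ∧ ‖k‖ ≤ ‖k + κ‖ := by
  -- The sign convention for real κ settles the borderline case `(k ^ 2).im = γ`.
  obtain ⟨κ, hκ, hκ0, hκ1⟩ : ∃ κ : ℂ, κ ^ 2 = k ^ 2 - Complex.I * γ ∧ 0 ≤ κ.im ∧
      (κ.im = 0 → 0 ≤ κ.re) := by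
    obtain ⟨κ, hκ⟩ := IsAlgClosed.exists_pow_nat_eq (k ^ 2 - Complex.I * γ) (n := 2) (by norm_num)
    have hκ' : (-κ) ^ 2 = k ^ 2 - Complex.I * γ := by rw [neg_sq, hκ]
    rcases lt_trichotomy κ.im 0 with h | h | h
    · exact ⟨-κ, hκ', by simpa using h.le, fun h0 => absurd h0 (by simpa using h.ne)⟩
    · rcases le_total 0 κ.re with h' | h'
      · exact ⟨κ, hκ, h.ge, fun _ => h'⟩
      · exact ⟨-κ, hκ', by simp [h], fun _ => by simpa using h'⟩
    · exact ⟨κ, hκ, h.le, fun h0 => absurd h0 h.ne'⟩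
  refine ⟨κ, hκ, hκ0, ?_⟩
  have e1 := congrArg Complex.re hκ
  have e2 := congrArg Complex.im hκ
  simp only [sq, Complex.mul_re, Complex.mul_im, Complex.sub_re, Complex.sub_im, Complex.I_re,
    Complex.I_im, Complex.ofReal_re, Complex.ofReal_im] at e1 e2
  -- It suffices that `k` and κ form an angle of at most π/2. If `(k ^ 2).im ≤ 0`, both lie in the
  -- closed second quadrant; if `(k ^ 2).im ≥ γ`, both lie in the closed first. In between, being
  -- outside the half-strip forces `(k ^ 2).re ≤ 0`, and both are within π/4 of the imaginary axis.
  have key : 0 ≤ k.re * κ.re + k.im * κ.im := by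
    rcases le_or_gt (k.re * k.im) 0 with h1 | h1
    · have ha : k.re ≤ 0 := by
        by_contra! h
        linarith [mul_pos h hk]
      have hc : κ.re ≤ 0 := by
        by_contra! h
        linarith [mul_nonneg h.le hκ0]
      linarith [mul_nonneg_of_nonpos_of_nonpos ha hc, mul_nonneg hk.le hκ0]
    have ha : 0 < k.re := pos_of_mul_pos_left h1 hk.le
    rcases le_or_gt γ (2 * (k.re * k.im)) with h2 | h2
    · have hc : 0 ≤ κ.re := by
        rcases hκ0.eq_or_lt with h | h
        · exact hκ1 h.symm
        · by_contra! hc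
          linarith [mul_neg_of_neg_of_pos hc h]
      linarith [mul_nonneg ha.le hc, mul_nonneg hk.le hκ0]
    · have h3 : k.re ^ 2 ≤ k.im ^ 2 := by
        by_contra! h
        refine hz ⟨?_, ?_, ?_⟩ <;>
          simp only [sq, Complex.mul_re, Complex.mul_im] <;> nlinarith
      have h4 : κ.re ^ 2 ≤ κ.im ^ 2 := by linarith
      have h5 := abs_le_of_sq_le_sq h3 hk.le
      have h6 := abs_le_of_sq_le_sq h4 hκ0
      have h7 : |k.re * κ.re| ≤ k.im * κ.im := by
        rw [abs_mul]
        gcongr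
      linarith [neg_abs_le (k.re * κ.re)]
  refine abs_le_of_sq_le_sq' ?_ (norm_nonneg _) |>.2
  rw [← Complex.normSq_eq_norm_sq, ← Complex.normSq_eq_norm_sq, Complex.normSq_apply,
    Complex.normSq_apply, Complex.add_re, Complex.add_im]
  nlinarith [sq_nonneg κ.re, sq_nonneg κ.im]

section Enclosure

variable {q : ℝ → ℂ} {γ a R : ℝ}

theorem barrierPotential_of_mem {t : ℝ} (ht : t ∈ Icc 0 R) :
    barrierPotential q γ R t = q t + Complex.I * γ := by
  simp [barrierPotential, ht]

theorem barrierPotential_of_gt {t : ℝ} (ht : R < t) : barrierPotential q γ R t = q t := by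
  simp [barrierPotential, ht.not_ge]

theorem integral_Ioi_norm_barrierPotential_le (hq : IntegrableOn q (Ioi 0)) (hR : 0 ≤ R) :
    ∫ t in Ioi R, ‖barrierPotential q γ R t‖ ≤ ∫ t in Ioi 0, ‖q t‖ := by
  rw [setIntegral_congr_fun measurableSet_Ioi (g := fun t => ‖q t‖)
    fun t ht => by rw [barrierPotential_of_gt ht]]
  exact setIntegral_mono_set hq.norm (Eventually.of_forall fun t => norm_nonneg _)
    (Ioi_subset_Ioi hR).eventuallyLE

/-- Estimates for the Jost solution at the end of the barrier. -/
theorem jost_at_barrier_end (hV : ExpDecay (barrierPotential q γ R) 0)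
    (hq : IntegrableOn q (Ioi 0)) (hR : 0 ≤ R) {k : ℂ} (hk : 0 ≤ k.im)
    (hk1 : 16 * (∫ t in Ioi 0, ‖q t‖) ≤ ‖k‖) (hk0 : 0 < ‖k‖) :
    ‖jostM (barrierPotential q γ R) k R - 1‖ ≤ 1 / 8 ∧
      ‖jostP (barrierPotential q γ R) k R‖ ≤ 6 * ∫ t in Ioi 0, ‖q t‖ := by
  set V := barrierPotential q γ R with hVdef
  set L := ∫ t in Ioi 0, ‖q t‖ with hL
  have hL0 : 0 ≤ L := setIntegral_nonneg measurableSet_Ioi fun t _ => norm_nonneg _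
  have hk' : -(0 : ℝ) ≤ k.im := by simpa using hk
  -- In the closed upper half-plane the kernel is at most `1 / ‖k‖`. Beyond `R` only `q` is left, so
  -- the estimates at `R` do not depend on `R` or γ.
  have hρ : IsJostWeight V k fun t => ‖k‖⁻¹ * ‖V t‖ := by
    refine ⟨hV.integrableOn.norm.const_mul _, fun x t hx hxt => ?_⟩
    refine mul_le_mul_of_nonneg_right ?_ (norm_nonneg _)
    have h1 := norm_mul_phaseInt_le le_rfl hk' (sub_nonneg.2 hxt.le)
    rw [mul_zero, zero_mul, Real.exp_zero] at h1
    rw [← one_div, le_div_iff₀ hk0, mul_comm]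
    exact h1
  have htail : ∀ x, R ≤ x → ∫ t in Ioi x, ‖k‖⁻¹ * ‖V t‖ ≤ L / ‖k‖ := fun x hx => by
    rw [integral_const_mul, inv_mul_eq_div]
    refine div_le_div_of_nonneg_right (le_trans ?_ (integral_Ioi_norm_barrierPotential_le
      (γ := γ) hq hR)) hk0.le
    exact setIntegral_mono_set (hV.integrableOn.mono_set (Ioi_subset_Ioi hR)).norm
      (Eventually.of_forall fun t => norm_nonneg _) (Ioi_subset_Ioi hx).eventuallyLE
  have hLk : L / ‖k‖ ≤ 1 / 16 := by
    rw [div_le_div_iff₀ hk0 (by norm_num)]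
    linarith
  have hLk0 : 0 ≤ L / ‖k‖ := by positivity
  have hexp := exp_sub_one_le_two_mul hLk0 (by linarith)
  have hm1 : ∀ x, R ≤ x → ‖jostM V k x - 1‖ ≤ 2 * (L / ‖k‖) := fun x hx =>
    (hρ.norm_jostM_sub_one_le hV hk' (hR.trans hx)).trans
      ((sub_le_sub_right (Real.exp_le_exp.2 (htail x hx)) 1).trans hexp)
  have hm2 : ∀ x, R ≤ x → ‖jostM V k x‖ ≤ 2 := fun x hx => by
    have h1 := norm_sub_norm_le (jostM V k x) 1
    rw [norm_one] at h1
    linarith [hm1 x hx]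
  refine ⟨(hm1 R le_rfl).trans (by linarith), ?_⟩
  have h1 : ‖∫ t in Ioi R, V t * jostM V k t‖ ≤ 2 * L := by
    refine (norm_integral_le_of_norm_le (g := fun t => 2 * ‖V t‖)
      ((hV.integrableOn.mono_set (Ioi_subset_Ioi hR)).norm.const_mul 2)
      (ae_restrict_of_forall_mem measurableSet_Ioi fun t ht => ?_)).trans ?_
    · rw [norm_mul, mul_comm]
      exact mul_le_mul_of_nonneg_right (hm2 t (le_of_lt ht)) (norm_nonneg _)
    · rw [integral_const_mul]
      have := integral_Ioi_norm_barrierPotential_le (γ := γ) hq hR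
      linarith
  have h2 : volterra k (fun t => V t * jostM V k t) R = jostM V k R - 1 := by
    rw [hV.jostM_eq hk' hR]
    ring
  have h3 : ‖2 * Complex.I * k * (jostM V k R - 1)‖ ≤ 4 * L := by
    rw [norm_mul, norm_mul, norm_mul, Complex.norm_I, Complex.norm_ofNat, mul_one]
    calc 2 * ‖k‖ * ‖jostM V k R - 1‖ ≤ 2 * ‖k‖ * (2 * (L / ‖k‖)) := by
          gcongr
          exact hm1 R le_rfl
      _ = 4 * L := by
          field_simp
          ring
  rw [jostP, h2]
  exact (norm_add_le _ _).trans (by linarith)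

/-- Variation of constants on the barrier, with the free exponential factored out. -/
theorem barrier_duhamel (hV : ExpDecay (barrierPotential q γ R) 0) {k κ : ℂ} (hk : 0 ≤ k.im)
    (hκ : κ ^ 2 = k ^ 2 - Complex.I * γ) {x : ℝ} (hx : x ∈ Icc 0 R) :
    Complex.exp (Complex.I * (-κ) * x) * jost (barrierPotential q γ R) k x
      = Complex.exp (Complex.I * (-κ) * R) * jost (barrierPotential q γ R) k R
        - Complex.exp (Complex.I * (-κ) * R) * (jostDeriv (barrierPotential q γ R) k R
            - Complex.I * κ * jost (barrierPotential q γ R) k R) * phaseInt κ (R - x)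
        + ∫ t in x..R, q t * (Complex.exp (Complex.I * (-κ) * t)
            * jost (barrierPotential q γ R) k t) * phaseInt κ (t - x) := by
  set V := barrierPotential q γ R with hVdef
  have hk' : -(0 : ℝ) ≤ k.im := by simpa using hk
  have hR : 0 ≤ R := hx.1.trans hx.2
  have hψ := hV.jost_isPrimitiveOn hk' hR
  have hχ := hV.jostDeriv_isPrimitiveOn hk' hR
  have he := isPrimitiveOn_exp_I_mul (-κ) hR
  have hD : IsPrimitiveOn (fun t => phaseInt κ (t - x))
      (fun t : ℝ => Complex.exp (2 * Complex.I * κ * ((t - x : ℝ) : ℂ))) 0 R :=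
    IsPrimitiveOn.of_hasDerivAt hR (fun t => by
      simpa using (phaseInt_hasDerivAt κ (t - x)).comp_sub_const t x) (by fun_prop)
  -- With E = e^{-iκt} and D the kernel in t - x, the function Eψ - E(ψ' - iκψ)D has derivative
  -- -qEψD: the barrier term cancels by the choice of κ. At t = x it reduces to Eψ because D
  -- vanishes there.
  have hJ := ((he.mul hψ).sub ((he.mul (hχ.sub (hψ.const_mul (Complex.I * κ)))).mul hD)).congr_deriv
    (f'' := fun t => -(q t * (Complex.exp (Complex.I * (-κ) * t) * jost V k t)
      * phaseInt κ (t - x))) fun t ht => by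
      have h1 : V t = q t + Complex.I * γ := barrierPotential_of_mem ht
      have h2 := mul_phaseInt κ (t - x)
      rw [h1, show Complex.exp (2 * Complex.I * κ * ((t - x : ℝ) : ℂ))
        = 1 + 2 * Complex.I * κ * phaseInt κ (t - x) by rw [h2]; ring]
      linear_combination (Complex.exp (Complex.I * (-κ) * t) * jost V k t
        * phaseInt κ (t - x)) * (κ ^ 2 * Complex.I_sq - hκ)
  have h := hJ.sub_eq hx (right_mem_Icc.2 hR)
  rw [intervalIntegral.integral_neg] at h
  have h0 : phaseInt κ (x - x) = 0 := by simp [phaseInt]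
  rw [h0, mul_zero, sub_zero] at h
  linear_combination -h

/-- Since (k - κ)(k + κ) = iγ, the root near k satisfies |k - κ| ≤ γ. At x = R the Jost solution is
thus almost a pure wave e^{iκx}, up to terms small compared with |κ|. Variation of constants carries
this back to x = 0 with errors of relative size O(1/|κ|), uniformly in R. -/
theorem jostM_zero_ne_zero (hV : ExpDecay (barrierPotential q γ R) 0)
    (hq : IntegrableOn q (Ioi 0)) (hγ : 0 < γ) (hR : 0 ≤ R) {k κ : ℂ} (hk : 0 ≤ k.im)
    (hκ : κ ^ 2 = k ^ 2 - Complex.I * γ) (hκ0 : 0 ≤ κ.im) (hkκ : ‖k‖ ≤ ‖k + κ‖)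
    (hk1 : 1 + 16 * (2 * γ + 6 * ∫ t in Ioi 0, ‖q t‖) ≤ ‖k‖)
    (hκ1 : 1 + 16 * (2 * γ + 6 * ∫ t in Ioi 0, ‖q t‖) ≤ ‖κ‖) :
    jostM (barrierPotential q γ R) k 0 ≠ 0 := by
  set V := barrierPotential q γ R with hVdef
  set L := ∫ t in Ioi 0, ‖q t‖ with hL
  have hL0 : 0 ≤ L := setIntegral_nonneg measurableSet_Ioi fun t _ => norm_nonneg _
  have hk0 : 0 < ‖k‖ := by linarith
  have hκpos : 0 < ‖κ‖ := by linarith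
  obtain ⟨hm, hp⟩ := jost_at_barrier_end hV hq hR hk (by linarith) hk0
  rw [← hVdef] at hm hp
  have hk' : -(0 : ℝ) ≤ k.im := by simpa using hk
  set n : ℝ → ℂ := fun x => Complex.exp (Complex.I * (-κ) * x) * jost V k x with hn
  set e : ℝ := ‖Complex.exp (Complex.I * (-κ) * R) * Complex.exp (Complex.I * k * R)‖ with he
  have he0 : 0 < e := norm_pos_iff.2 (mul_ne_zero (Complex.exp_ne_zero _) (Complex.exp_ne_zero _))
  have hnR : ‖n R‖ = e * ‖jostM V k R‖ := by
    rw [he, ← norm_mul, hn]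
    simp only [jost, mul_assoc]
  have hmle : ‖jostM V k R‖ ≤ 2 := by
    have h1 := norm_sub_norm_le (jostM V k R) 1
    rw [norm_one] at h1
    linarith
  have hmge : 7 / 8 ≤ ‖jostM V k R‖ := by
    have h1 := norm_sub_norm_le 1 (jostM V k R)
    rw [norm_one, norm_sub_rev] at h1
    linarith
  set d : ℂ := Complex.exp (Complex.I * (-κ) * R) * (jostDeriv V k R - Complex.I * κ * jost V k R)
    with hd
  have hdiff : ‖k - κ‖ ≤ γ := by
    have h1 : ‖k - κ‖ * ‖k + κ‖ = γ := by
      rw [← norm_mul, show (k - κ) * (k + κ) = Complex.I * γ by linear_combination -hκ, norm_mul,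
        Complex.norm_I, one_mul, Complex.norm_real, Real.norm_of_nonneg hγ.le]
    have h2 : 1 ≤ ‖k + κ‖ := by linarith
    nlinarith [norm_nonneg (k - κ)]
  have hdle : ‖d‖ ≤ e * (2 * γ + 6 * L) := by
    have h1 : d = Complex.exp (Complex.I * (-κ) * R) * Complex.exp (Complex.I * k * R)
        * (Complex.I * (k - κ) * jostM V k R - jostP V k R) := by
      rw [hd, jostDeriv, jost]
      ring
    rw [h1, norm_mul, ← he]
    refine mul_le_mul_of_nonneg_left ((norm_sub_le _ _).trans (add_le_add ?_ hp)) he0.le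
    rw [norm_mul, norm_mul, Complex.norm_I, one_mul, mul_comm 2]
    exact mul_le_mul hdiff hmle (norm_nonneg _) hγ.le
  have hncont : ContinuousOn n (Icc 0 R) :=
    ((isPrimitiveOn_exp_I_mul (-κ) hR).mul (hV.jost_isPrimitiveOn hk' hR)).continuousOn
  obtain ⟨x₀, hx₀, hmax⟩ := isCompact_Icc.exists_isMaxOn (nonempty_Icc.2 hR) hncont.norm
  set M := ‖n x₀‖ with hM
  have hD : ∀ s, 0 ≤ s → ‖phaseInt κ s‖ ≤ ‖κ‖⁻¹ := fun s hs => by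
    have h1 := norm_mul_phaseInt_le le_rfl (show -(0 : ℝ) ≤ κ.im by simpa using hκ0) hs
    rw [mul_zero, zero_mul, Real.exp_zero] at h1
    rw [← one_div, le_div_iff₀ hκpos, mul_comm]
    exact h1
  have hest : ∀ x ∈ Icc 0 R, ‖n x - n R‖ ≤ e / 16 + M / 16 := by
    intro x hx
    have h1 := barrier_duhamel hV hk hκ hx
    have h2 : n x - n R = -(d * phaseInt κ (R - x))
        + ∫ t in x..R, q t * n t * phaseInt κ (t - x) := by
      simp only [hn, hd]
      rw [h1]
      ring
    have h3 : ‖d * phaseInt κ (R - x)‖ ≤ e / 16 := by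
      rw [norm_mul]
      calc ‖d‖ * ‖phaseInt κ (R - x)‖ ≤ e * (2 * γ + 6 * L) * ‖κ‖⁻¹ :=
            mul_le_mul hdle (hD _ (by linarith [hx.2])) (norm_nonneg _) (by positivity)
        _ ≤ e / 16 := by
            rw [← div_eq_mul_inv, div_le_div_iff₀ hκpos (by norm_num)]
            nlinarith
    have h4 : ‖∫ t in x..R, q t * n t * phaseInt κ (t - x)‖ ≤ M / 16 := by
      have hqi : IntegrableOn (fun t => ‖q t‖) (Ioc x R) :=
        (hq.mono_set fun t ht => lt_of_le_of_lt hx.1 ht.1).norm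
      rw [intervalIntegral.integral_of_le hx.2]
      have h5 : ‖∫ t in Ioc x R, q t * n t * phaseInt κ (t - x)‖
          ≤ ∫ t in Ioc x R, ‖q t‖ * (M * ‖κ‖⁻¹) := by
        refine norm_integral_le_of_norm_le (hqi.mul_const _)
          (ae_restrict_of_forall_mem measurableSet_Ioc fun t ht => ?_)
        rw [norm_mul, norm_mul, mul_assoc]
        refine mul_le_mul_of_nonneg_left (mul_le_mul ?_ (hD _ (by linarith [ht.1]))
          (norm_nonneg _) (norm_nonneg _)) (norm_nonneg _)
        exact hmax ⟨hx.1.trans ht.1.le, ht.2⟩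
      refine h5.trans ?_
      rw [integral_mul_const]
      have h6 : ∫ t in Ioc x R, ‖q t‖ ≤ L :=
        setIntegral_mono_set hq.norm (Eventually.of_forall fun t => norm_nonneg _)
          (LE.le.eventuallyLE fun t ht => lt_of_le_of_lt hx.1 ht.1)
      have h7 : L * ‖κ‖⁻¹ ≤ 1 / 16 := by
        rw [← div_eq_mul_inv, div_le_div_iff₀ hκpos (by norm_num)]
        linarith
      calc (∫ t in Ioc x R, ‖q t‖) * (M * ‖κ‖⁻¹) ≤ L * (M * ‖κ‖⁻¹) := by
            gcongr
        _ = M * (L * ‖κ‖⁻¹) := by ring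
        _ ≤ M * (1 / 16) := by gcongr
        _ = M / 16 := by ring
    rw [h2]
    refine (norm_add_le _ _).trans (add_le_add ?_ h4)
    rwa [norm_neg]
  -- The estimate at the maximum point closes on itself, since only `M / 16` reappears on the right.
  -- A zero at `x = 0` would then force `7 e / 8 ≤ e / 16 + 3 e / 16`.
  have hMle : M ≤ 3 * e := by
    have h1 := hest x₀ hx₀
    have h2 := norm_sub_norm_le (n x₀) (n R)
    have h3 : ‖n R‖ ≤ e * 2 := by
      rw [hnR]
      gcongr
    linarith
  intro hzero
  have h0 := hest 0 (left_mem_Icc.2 hR)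
  have hn0 : n 0 = 0 := by simp [hn, jost, hzero]
  rw [hn0, zero_sub, norm_neg, hnR] at h0
  have : e * (7 / 8) ≤ e * ‖jostM V k R‖ := by gcongr
  linarith

theorem exists_enclosesEigenvalues (hγ : 0 < γ) (ha : 0 < a) (hq : IntegrableOn q (Ioi 0))
    (hN : IntegrableOn (fun t : ℝ => Real.exp (4 * a * t) * ‖q t‖) (Ioi 0)) :
    ∃ X : ℝ, 0 < X ∧ EnclosesEigenvalues q γ X := by
  set L := ∫ t in Ioi 0, ‖q t‖ with hL
  have hL0 : 0 ≤ L := setIntegral_nonneg measurableSet_Ioi fun t _ => norm_nonneg _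
  set K := 1 + 16 * (2 * γ + 6 * L) with hK
  have hK0 : 0 < K := by positivity
  -- The extra γ makes `‖κ‖ ≥ K` as well as `‖k‖ ≥ K`, because `‖κ‖ ^ 2 ≥ ‖k‖ ^ 2 - γ`.
  refine ⟨K ^ 2 + γ, by positivity, fun R hR z hz => ?_⟩
  rw [dissipativeOp_eq] at hz
  have hV : ExpDecay (barrierPotential q γ R) 0 :=
    barrier_expDecay hγ.le ha hq hN le_rfl ha.le hR.le
  obtain ⟨k, rfl, hk, hzero⟩ := hV.eigenvalue_sq hz
  by_contra hnot
  simp only [mem_union, Metric.mem_ball, dist_zero_right, not_or, not_lt] at hnot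
  obtain ⟨κ, hκ, hκ0, hkκ⟩ := exists_sqrt_near hγ hk hnot.2
  have hk2 := hnot.1
  have hκ2 : K ^ 2 ≤ ‖κ‖ ^ 2 := by
    have h1 := norm_sub_norm_le (k ^ 2) (Complex.I * γ)
    rw [norm_mul, Complex.norm_I, one_mul, Complex.norm_real, Real.norm_of_nonneg hγ.le] at h1
    rw [← norm_pow, hκ]
    linarith
  rw [norm_pow] at hk2
  exact jostM_zero_ne_zero hV hq hγ hR.le hk.le hκ hκ0 hkκ
    (abs_le_of_sq_le_sq' (by linarith) (norm_nonneg _)).2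
    (abs_le_of_sq_le_sq' hκ2 (norm_nonneg _)).2 hzero

end Enclosure

theorem theorem3p6 (q : ℝ → ℂ) (γ a : ℝ) (hγ : 0 < γ) (ha : 0 < a)
    (hq : IntegrableOn q (Ioi 0))
    (hN : IntegrableOn (fun t : ℝ => Real.exp (4 * a * t) * ‖q t‖) (Ioi 0)) :
    (∃ X : ℝ, 0 < X ∧ EnclosesEigenvalues q γ X) ∧
    ∀ X : ℝ, 0 < X → EnclosesEigenvalues q γ X →
      ∃ R₀ : ℝ, 0 < R₀ ∧ ∀ R : ℝ, R₀ ≤ R →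
        numEigenvalues (dissipativeOp q γ R) ≤
          ENNReal.ofReal
            (88788 * ((√X + a) / a ^ 2) * (γ ^ 2 * R ^ 3 / (Real.log R) ^ 2)) := by
  refine ⟨exists_enclosesEigenvalues hγ ha hq hN, fun X hX _ => ?_⟩
  obtain ⟨C, hC⟩ := numEigenvalues_le hγ.le ha hq hN
  -- Only positivity of the prefactor matters: a count of order R^{5/2} is eventually below any
  -- positive multiple of R³/log² R.
  have hc : 0 < 88788 * ((√X + a) / a ^ 2) * γ ^ 2 := by positivity
  obtain ⟨R₁, hR₁⟩ := eventually_atTop.1 (eventually_le_cube_div_log_sq C hc)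
  refine ⟨max R₁ (max 1 (1 / a)), by positivity, fun R hR => ?_⟩
  have h1 : R₁ ≤ R := (le_max_left _ _).trans hR
  have h2 : max 1 (1 / a) ≤ R := (le_max_right _ _).trans hR
  refine (hC R ((le_max_left _ _).trans h2) ((le_max_right _ _).trans h2)).trans
    (ENNReal.ofReal_le_ofReal ((hR₁ R h1).trans_eq ?_))
  ring
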